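/- **Definitions.** For a Lipschitz self-map $\phi$ of a metric space let $\mathrm{Lip}(\phi)$ be the infimum of all $L>0$ for which $\phi$ is $L$-Lipschitz. An *infinite iterated function system* (IIFS) on a compact metric space $X$ is a countably infinite collection $\mathcal F=\{\phi_i : i\in\mathbb N\}$ of distinct maps $\phi_i:X\to X$ with $\mathrm{Lip}(\phi_i)\in(0,1)$. Its *attractor* is $$K=\bigcup_{(i_n)\in\mathbb N^{\mathbb N}}\ \bigcap_{n=1}^{\infty}\phi_{i_1}\circ\cdots\circ\phi_{i_n}(X),$$ and its *similarity dimension* is $\operatorname{s-dim}(\mathcal F)=\inf\{t\ge 0:\sum_{i}\mathrm{Lip}(\phi_i)^t\le 1\}$ (with $\inf\emptyset=\infty$). An IIFS on $[0,1]^2$ (with the Euclidean metric) is *of similarities* if each $\phi_i$ is the restriction to $[0,1]^2$ of the composition of a dilation and an isometry of $\mathbb R^2$. It satisfies the *open set condition* if there is a nonempty set $U\subset[0,1]^2$, open in $\mathbb R^2$, such that $\phi_i(U)\subset U$ for all $i$ and $\phi_i(U)\cap\phi_j(U)=\emptyset$ for all $i\ne j$. A *continuum* is a nonempty compact connected set,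 a *curve* is a continuous map defined on $[0,1]$, and a *Hölder curve* is a map $f$ defined on $[0,1]$ for which there are $C\ge 0$ and $r>0$ with $|f(x)-f(y)|\le C|x-y|^{r}$ for all $x,y\in[0,1]$. **Theorem 1.1.** 1. For each $\varepsilon>0$ there exists an IIFS $\mathcal F$ of similarities on $[0,1]^2$ that satisfies the open set condition, such that $\operatorname{s-dim}(\mathcal F)<1+\varepsilon$ and the attractor of $\mathcal F$ is a continuum but is not path connected. 2. For each $\varepsilon>0$ there exists an IIFS $\mathcal F$ of similarities on $[0,1]^2$ that satisfies the open set condition, such that $\operatorname{s-dim}(\mathcal F)<1+\varepsilon$ and the attractor of $\mathcal F$ is the image of a curve but is not the image of a Hölder curve. -/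

import Mathlib

open scoped NNReal ENNReal

noncomputable section

namespace IIFS

/-- `Lip f`: the infimum of all `L > 0` for which `f` is `L`-Lipschitz
(only used for Lipschitz maps). -/
def lip {X : Type*} [MetricSpace X] (f : X → X) : ℝ≥0 :=
  sInf {L : ℝ≥0 | 0 < L ∧ LipschitzWith L f}

/-- An infinite iterated function system on a compact metric space: a countably infinite
collection `{φ_i : i ∈ ℕ}` of (pairwise distinct) contractions with `0 < Lip φ_i < 1`. -/
structure System (X : Type*) [MetricSpace X] [CompactSpace X] where
  map : ℕ → X → X
  injective : Function.Injective map
  lipschitz : ∀ i, ∃ L : ℝ≥0, LipschitzWith L (map i)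
  lip_pos : ∀ i, 0 < lip (map i)
  lip_lt_one : ∀ i, lip (map i) < 1

namespace System

variable {X : Type*} [MetricSpace X] [CompactSpace X]

/-- `φ_{w 0} ∘ ⋯ ∘ φ_{w (n - 1)}`, the composition along the first `n` letters of `w`. -/
def word (F : System X) (w : ℕ → ℕ) : ℕ → X → X
  | 0 => id
  | n + 1 => word F w n ∘ F.map (w n)

/-- The attractor `⋃_w ⋂_{n ≥ 1} φ_{w 0} ∘ ⋯ ∘ φ_{w (n - 1)} (X)`. -/
def attractor (F : System X) : Set X :=
  ⋃ w : ℕ → ℕ, ⋂ n : ℕ, Set.range (F.word w (n + 1))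

/-- `ψ_F(t) = ∑_i (Lip φ_i)^t`, with values in `[0, ∞]`. -/
def psi (F : System X) (t : ℝ≥0) : ℝ≥0∞ :=
  ∑' i, ((lip (F.map i) ^ (t : ℝ) : ℝ≥0) : ℝ≥0∞)

/-- The similarity dimension `inf {t ≥ 0 : ψ_F(t) ≤ 1}`, taken in `[0, ∞]`, so that it is `∞`
when there is no such `t`. -/
def sdim (F : System X) : ℝ≥0∞ :=
  ⨅ (t : ℝ≥0) (_ : F.psi t ≤ 1), (t : ℝ≥0∞)

end System

/-- A self-map of `X ⊆ ℝⁿ` is a similarity if it is the restriction of the composition of a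
dilation with ratio `r > 0` and an isometry of `ℝⁿ`. -/
def IsSimilarity {n : ℕ} {X : Set (EuclideanSpace ℝ (Fin n))} (φ : X → X) : Prop :=
  ∃ r : ℝ, 0 < r ∧ ∃ g : EuclideanSpace ℝ (Fin n) ≃ᵢ EuclideanSpace ℝ (Fin n),
    ∀ x : X, (φ x : EuclideanSpace ℝ (Fin n)) = r • g x

/-- The open set condition for a system on a compact `X ⊆ ℝⁿ`: there is a nonempty `U ⊆ X`, open
in `ℝⁿ`, with `φ_i(U) ⊆ U` for all `i` and `φ_i(U) ∩ φ_j(U) = ∅` for all `i ≠ j`. -/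
def System.OpenSetCondition {n : ℕ} {X : Set (EuclideanSpace ℝ (Fin n))} [CompactSpace X]
    (F : System X) : Prop :=
  ∃ U : Set X, U.Nonempty ∧ IsOpen (Subtype.val '' U : Set (EuclideanSpace ℝ (Fin n))) ∧
    (∀ i, F.map i '' U ⊆ U) ∧ ∀ i j, i ≠ j → F.map i '' U ∩ F.map j '' U = ∅

/-- A continuum: a nonempty, compact and connected set. -/
def IsContinuum {X : Type*} [TopologicalSpace X] (K : Set X) : Prop :=
  IsCompact K ∧ IsConnected K

/-- `K` is the image of a curve, i.e. of a continuous map on `[0,1]`. -/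
def IsCurveImage {X : Type*} [TopologicalSpace X] (K : Set X) : Prop :=
  ∃ f : Set.Icc (0 : ℝ) 1 → X, Continuous f ∧ Set.range f = K

/-- `K` is the image of a Hölder curve, i.e. of a map on `[0,1]` that is Hölder continuous with
some exponent `r > 0`. -/
def IsHolderCurveImage {X : Type*} [MetricSpace X] (K : Set X) : Prop :=
  ∃ (C r : ℝ≥0) (f : Set.Icc (0 : ℝ) 1 → X), 0 < r ∧ HolderWith C r f ∧ Set.range f = K

/-- The unit square `[0,1]²` with the Euclidean metric. -/
def unitSquare : Set (EuclideanSpace ℝ (Fin 2)) :=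
  {x | ∀ i, x i ∈ Set.Icc (0 : ℝ) 1}

instance compactSpace_unitSquare : CompactSpace unitSquare := by
  rw [← isCompact_iff_compactSpace]
  have h : IsCompact (Set.univ.pi fun _ : Fin 2 => Set.Icc (0 : ℝ) 1) :=
    isCompact_univ_pi fun _ => isCompact_Icc
  have h' := (EuclideanSpace.equiv (Fin 2) ℝ).toHomeomorph.isCompact_preimage.mpr h
  convert h' using 1
  ext x
  simp only [unitSquare, Set.mem_ofPred_eq, Set.mem_preimage, Set.mem_univ_pi]
  rfl

end IIFS

end

open Set Filter Topology Metric unitInterval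

noncomputable section

/-! Both systems come from one picture, drawn in units of 1/n. The family keeps the left column, the
bottom row and column 3 of the n × n grid. To the left of column 3 stand ever thinner columns of
squares of size `size k` that accumulate on the line x = 3. Columns k and k + 1 are linked by one
extra square, to the right of the `c k`-th square of column k. The left column and the bottom row
reproduce the left and bottom edges of the unit square, so the attractor contains these edges, and
hence the left and bottom edges of every square of the family. It is closed because the squares
accumulate only on x = 3, a line on which it contains the whole segment. Level k has at most 4 · 2^k
squares of ratio 2^(-k)/(4n), so the sum of the ratios to the power 1 + e is O(n^(-e)) for fixed e >
0. A large n thus makes the similarity dimension less than 1 + ε, whatever the heights and links.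

Part 1 (`zigzag`): columns of constant height, linked alternately at the bottom and at the top, as
in the topologist's sine curve. The chain of column feet converges to a point of x = 3, which gives
connectedness. A path from the columns to the origin must reach x = 3, and just before that it
passes low and high links infinitely often, against continuity.

Part 2 (`hairbrush`): all links at the bottom, heights of order 1/log k. Small squares are reached
from a hub on x = 3 by paths that shrink with the level, so a self-similar loop, the fixed point of
a contraction on continuous maps, fills the attractor (`SquareFamily.exists_curve`). Between two
column tips a curve must descend a column. Among the first 2^m + 2 tips two are visited within time
2^(-m), yet the descent is at least of order 1/m, which no Hölder condition allows.

The attractor is handled as the largest self-covered set `limitSet`; inclusions into closed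
invariant sets come from `subset_of_subset_iUnion`. -/

/-- The Euclidean plane. -/
abbrev Plane : Type := EuclideanSpace ℝ (Fin 2)

/-! ### Families of homotheties and their limit sets -/

/-- A family of homotheties `x ↦ b i + r i • x` mapping the unit square onto subsquares with
disjoint interiors. -/
structure SquareFamily (ι : Type*) where
  r : ι → ℝ
  b : ι → Plane
  r_pos : ∀ i, 0 < r i
  r_le : ∀ i, r i ≤ 1 / 4
  b_nonneg : ∀ i m, 0 ≤ b i m
  b_add_r_le : ∀ i m, b i m + r i ≤ 1
  eq_of_interiors_meet : ∀ i j (u v : Plane), (∀ m, u m ∈ Ioo (0 : ℝ) 1) →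
    (∀ m, v m ∈ Ioo (0 : ℝ) 1) → b i + r i • u = b j + r j • v → i = j

namespace SquareFamily

open IIFS

variable {ι : Type*} (Φ : SquareFamily ι)

/-- The homothety with index `i`. -/
def map (i : ι) (x : Plane) : Plane := Φ.b i + Φ.r i • x

@[simp] lemma map_apply (i : ι) (x : Plane) (m : Fin 2) :
    Φ.map i x m = Φ.b i m + Φ.r i * x m := by simp [map]

lemma map_zero (i : ι) : Φ.map i 0 = Φ.b i := by simp [map]

lemma continuous_map (i : ι) : Continuous (Φ.map i) := by
  unfold map; fun_prop

lemma dist_map (i : ι) (x y : Plane) : dist (Φ.map i x) (Φ.map i y) = Φ.r i * dist x y := by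
  simp [map, dist_smul₀, abs_of_pos (Φ.r_pos i)]

lemma map_mem_unitSquare (i : ι) {x : Plane} (hx : x ∈ unitSquare) : Φ.map i x ∈ unitSquare := by
  intro m
  have h1 := hx m
  have h2 := Φ.b_nonneg i m
  have h3 := Φ.b_add_r_le i m
  have h4 := Φ.r_pos i
  simp only [map_apply, mem_Icc] at *
  constructor <;> nlinarith

/-- The largest subset of the unit square that is covered by its images under the family. -/
def limitSet : Set Plane := ⋃₀ {A | A ⊆ unitSquare ∧ A ⊆ ⋃ i, Φ.map i '' A}

lemma limitSet_subset_unitSquare : Φ.limitSet ⊆ unitSquare :=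
  sUnion_subset fun _ hA => hA.1

lemma limitSet_subset_iUnion : Φ.limitSet ⊆ ⋃ i, Φ.map i '' Φ.limitSet := by
  refine sUnion_subset fun A hA x hx => ?_
  obtain ⟨i, y, hy, rfl⟩ := mem_iUnion.1 (hA.2 hx)
  exact mem_iUnion.2 ⟨i, y, mem_sUnion.2 ⟨A, hA, hy⟩, rfl⟩

/-- Coinduction principle: adjoining the limit set to `A` gives a self-covered set, so maximality
applies. -/
lemma subset_limitSet {A : Set Plane} (h : A ⊆ unitSquare)
    (h' : A ⊆ Φ.limitSet ∪ ⋃ i, Φ.map i '' A) : A ⊆ Φ.limitSet := by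
  suffices hA : A ∪ Φ.limitSet ∈ {A | A ⊆ unitSquare ∧ A ⊆ ⋃ i, Φ.map i '' A} from
    subset_union_left.trans (subset_sUnion_of_mem hA)
  have key : Φ.limitSet ⊆ ⋃ i, Φ.map i '' (A ∪ Φ.limitSet) :=
    Φ.limitSet_subset_iUnion.trans (iUnion_mono fun i => image_mono subset_union_right)
  refine ⟨union_subset h Φ.limitSet_subset_unitSquare, union_subset ?_ key⟩
  exact h'.trans (union_subset key (iUnion_mono fun i => image_mono subset_union_left))

lemma map_mem_limitSet (i : ι) {x : Plane} (hx : x ∈ Φ.limitSet) : Φ.map i x ∈ Φ.limitSet := by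
  refine Φ.subset_limitSet (A := {Φ.map i x} ∪ Φ.limitSet) ?_ ?_ (Or.inl rfl)
  · refine union_subset ?_ Φ.limitSet_subset_unitSquare
    rintro _ rfl
    exact Φ.map_mem_unitSquare i (Φ.limitSet_subset_unitSquare hx)
  · rintro y (rfl | hy)
    · exact Or.inr (mem_iUnion.2 ⟨i, x, Or.inr hx, rfl⟩)
    · exact Or.inl hy

lemma isBounded_unitSquare : Bornology.IsBounded unitSquare :=
  (isCompact_iff_compactSpace.2 inferInstance).isBounded

lemma isClosed_unitSquare : IsClosed unitSquare :=
  (isCompact_iff_compactSpace.2 inferInstance).isClosed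

/-- A bounded set that is covered by a closed invariant set and by its own images lies in that
invariant set. -/
lemma subset_of_subset_iUnion {A B : Set Plane} (hA : Bornology.IsBounded A) (hB : IsClosed B)
    (hB0 : B.Nonempty) (hinv : ∀ i, ∀ x ∈ B, Φ.map i x ∈ B)
    (h : A ⊆ B ∪ ⋃ i, Φ.map i '' A) : A ⊆ B := by
  obtain ⟨b, hb⟩ := hB0
  obtain ⟨R, hR⟩ := hA.subset_closedBall b
  -- A point of `A` outside `B` is the image of a point of `A`, and each map shrinks the distance to
  -- the invariant set `B` by a factor of at most 1/4.
  have key : ∀ n : ℕ, ∀ x ∈ A, infDist x B ≤ (1 / 4) ^ n * R := by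
    intro n
    induction n with
    | zero =>
      intro x hx
      simpa using (infDist_le_dist_of_mem hb).trans (hR hx)
    | succ n ih =>
      intro x hx
      have hR0 : 0 ≤ R := dist_nonneg.trans (hR hx)
      rcases h hx with hx | hx
      · rw [infDist_zero_of_mem hx]; positivity
      · obtain ⟨i, y, hy, rfl⟩ := mem_iUnion.1 hx
        have h1 : infDist (Φ.map i y) B ≤ Φ.r i * infDist y B := by
          obtain ⟨p, hp, hpy⟩ := hB.exists_infDist_eq_dist ⟨b, hb⟩ y
          rw [hpy, ← Φ.dist_map]
          exact infDist_le_dist_of_mem (hinv i p hp)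
        calc _ ≤ _ := h1
          _ ≤ (1 / 4) * ((1 / 4) ^ n * R) :=
            mul_le_mul (Φ.r_le i) (ih y hy) infDist_nonneg (by norm_num)
          _ = _ := by ring
  intro x hx
  have h0 : infDist x B ≤ 0 := by
    refine ge_of_tendsto' (x := atTop) (f := fun n : ℕ => (1 / 4 : ℝ) ^ n * R) ?_
      fun n => key n x hx
    simpa using (tendsto_pow_atTop_nhds_zero_of_lt_one (by norm_num : (0:ℝ) ≤ 1 / 4)
      (by norm_num)).mul_const R
  exact (hB.mem_iff_infDist_zero ⟨b, hb⟩).2 (le_antisymm h0 infDist_nonneg)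

/-- The limit set is closed if the family is locally finite off the limit set. -/
lemma isClosed_limitSet (h : ∀ x ∈ unitSquare, x ∉ Φ.limitSet →
    ∃ U ∈ 𝓝 x, {i | (Φ.map i '' unitSquare ∩ U).Nonempty}.Finite) : IsClosed Φ.limitSet := by
  have hsub : closure Φ.limitSet ⊆ unitSquare :=
    closure_minimal Φ.limitSet_subset_unitSquare isClosed_unitSquare
  -- By coinduction it suffices that the closure is self-covered off the limit set. There only
  -- finitely many images matter, and closure commutes with finite unions.
  refine isClosed_of_closure_subset (Φ.subset_limitSet hsub fun x hx => ?_)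
  by_cases hxK : x ∈ Φ.limitSet
  · exact Or.inl hxK
  obtain ⟨U, hU, hfin⟩ := h x (hsub hx) hxK
  have hx' : x ∈ closure (⋃ i ∈ {i | (Φ.map i '' unitSquare ∩ U).Nonempty},
      Φ.map i '' Φ.limitSet) := by
    rw [mem_closure_iff_nhds] at hx ⊢
    intro t ht
    obtain ⟨y, ⟨hyt, hyU⟩, hyK⟩ := hx _ (inter_mem ht hU)
    obtain ⟨i, p, hp, rfl⟩ := mem_iUnion.1 (Φ.limitSet_subset_iUnion hyK)
    exact ⟨_, hyt, mem_biUnion (x := i)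
      ⟨_, ⟨p, Φ.limitSet_subset_unitSquare hp, rfl⟩, hyU⟩ ⟨p, hp, rfl⟩⟩
  rw [hfin.closure_biUnion] at hx'
  obtain ⟨i, -, hi⟩ := mem_iUnion₂.1 hx'
  refine Or.inr (mem_iUnion.2 ⟨i, ?_⟩)
  have hcpt : IsCompact (Φ.map i '' closure Φ.limitSet) :=
    (isBounded_unitSquare.subset hsub).isCompact_closure.of_isClosed_subset isClosed_closure
      (by simp) |>.image (Φ.continuous_map i)
  exact closure_minimal (image_mono subset_closure) hcpt.isClosed hi

/-- The limit set is connected if all the points `b i` lie in the component of the origin. -/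
lemma isConnected_limitSet (hK : IsClosed Φ.limitSet) (h0 : 0 ∈ Φ.limitSet)
    (h : ∀ i, Φ.b i ∈ connectedComponentIn Φ.limitSet 0) : IsConnected Φ.limitSet := by
  set C := connectedComponentIn Φ.limitSet 0 with hC
  have hCK : C ⊆ Φ.limitSet := connectedComponentIn_subset _ _
  have hCc : IsPreconnected C := isPreconnected_connectedComponentIn
  have h0C : (0 : Plane) ∈ C := mem_connectedComponentIn h0
  have hclosed : IsClosed C := by
    refine isClosed_of_closure_subset ?_
    exact hCc.closure.subset_connectedComponentIn (subset_closure h0C)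
      (closure_minimal hCK hK)
  -- The component is closed, and it is invariant: the image of `C` under map `i` is connected and
  -- meets `C` at `b i`.
  have hsub : Φ.limitSet ⊆ C := by
    refine Φ.subset_of_subset_iUnion (isBounded_unitSquare.subset Φ.limitSet_subset_unitSquare)
      hclosed ⟨0, h0C⟩ (fun i x hx => ?_) (Φ.limitSet_subset_iUnion.trans subset_union_right)
    have h1 : IsPreconnected (Φ.map i '' C) := hCc.image _ (Φ.continuous_map i).continuousOn
    have h2 : Φ.map i '' C ⊆ connectedComponentIn Φ.limitSet (Φ.b i) :=
      h1.subset_connectedComponentIn ⟨0, h0C, Φ.map_zero i⟩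
        (image_subset_iff.2 fun y hy => Φ.map_mem_limitSet i (hCK hy))
    rw [hC, connectedComponentIn_eq (h i)]
    exact h2 ⟨x, hx, rfl⟩
  rw [← subset_antisymm hCK hsub]
  exact ⟨⟨0, h0C⟩, hCc⟩

/-! ### The iterated function system of a family of squares -/

/-- The homothety with index `i` as a self-map of the unit square. -/
def selfMap (i : ι) (x : unitSquare) : unitSquare := ⟨Φ.map i x, Φ.map_mem_unitSquare i x.2⟩

@[simp] lemma coe_selfMap (i : ι) (x : unitSquare) : (Φ.selfMap i x : Plane) = Φ.map i x := rfl

lemma dist_selfMap (i : ι) (x y : unitSquare) :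
    dist (Φ.selfMap i x) (Φ.selfMap i y) = Φ.r i * dist x y :=
  Φ.dist_map i x y

lemma lipschitzWith_selfMap (i : ι) : LipschitzWith (Φ.r i).toNNReal (Φ.selfMap i) :=
  LipschitzWith.of_dist_le_mul fun x y => by
    rw [Φ.dist_selfMap, Real.coe_toNNReal _ (Φ.r_pos i).le]

lemma zero_mem_unitSquare : (0 : Plane) ∈ unitSquare := fun m => by simp

lemma single_mem_unitSquare : EuclideanSpace.single (0 : Fin 2) (1 : ℝ) ∈ unitSquare := by
  intro m; fin_cases m <;> simp

lemma lip_selfMap (i : ι) : lip (Φ.selfMap i) = (Φ.r i).toNNReal := by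
  refine le_antisymm (csInf_le (OrderBot.bddBelow _)
    ⟨by simpa using Φ.r_pos i, Φ.lipschitzWith_selfMap i⟩) (le_csInf ⟨_, by simpa using Φ.r_pos i,
      Φ.lipschitzWith_selfMap i⟩ ?_)
  rintro L ⟨-, hL⟩
  have := hL.dist_le_mul ⟨_, single_mem_unitSquare⟩ ⟨0, zero_mem_unitSquare⟩
  rw [Φ.dist_selfMap] at this
  simp only [Subtype.dist_eq, dist_zero_right, PiLp.norm_single, norm_one, mul_one] at this
  exact Real.toNNReal_le_iff_le_coe.2 this

/-- The open unit square. -/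
def openSquare : Set unitSquare := {x | ∀ m, (x : Plane) m ∈ Ioo (0 : ℝ) 1}

lemma centre_mem : (!₂[1 / 2, 1 / 2] : Plane) ∈ unitSquare := by
  intro m; fin_cases m <;> norm_num

lemma centre_mem_openSquare : (⟨!₂[1 / 2, 1 / 2], centre_mem⟩ : unitSquare) ∈ openSquare := by
  intro m; fin_cases m <;> norm_num

lemma selfMap_injective : Function.Injective Φ.selfMap := by
  intro i j hij
  have := congrArg (Subtype.val (p := (· ∈ unitSquare)))
    (congrFun hij ⟨!₂[1 / 2, 1 / 2], centre_mem⟩)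
  exact Φ.eq_of_interiors_meet i j _ _ centre_mem_openSquare centre_mem_openSquare this

/-- The iterated function system of an enumerated family of squares. -/
def system (e : ℕ ≃ ι) : System unitSquare where
  map k := Φ.selfMap (e k)
  injective := Φ.selfMap_injective.comp e.injective
  lipschitz k := ⟨_, Φ.lipschitzWith_selfMap _⟩
  lip_pos k := by simpa [lip_selfMap] using Φ.r_pos _
  lip_lt_one k := by
    simpa [lip_selfMap] using (Φ.r_le (e k)).trans_lt (by norm_num : (1 / 4 : ℝ) < 1)

variable (e : ℕ ≃ ι)

lemma isSimilarity_system (k : ℕ) : IsSimilarity ((Φ.system e).map k) := by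
  have hr := Φ.r_pos (e k)
  refine ⟨Φ.r (e k), hr, IsometryEquiv.addLeft ((Φ.r (e k))⁻¹ • Φ.b (e k)), fun x => ?_⟩
  simp [system, map, smul_smul, hr.ne']

lemma openSetCondition_system : (Φ.system e).OpenSetCondition := by
  refine ⟨openSquare, ⟨_, centre_mem_openSquare⟩, ?_, ?_, ?_⟩
  · have : (Subtype.val '' openSquare : Set Plane) = ⋂ m, {x | x m ∈ Ioo (0 : ℝ) 1} := by
      ext x
      simp only [mem_image, mem_iInter]
      constructor
      · rintro ⟨y, hy, rfl⟩ m
        exact hy m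
      · intro h
        exact ⟨⟨x, fun m => Ioo_subset_Icc_self (h m)⟩, h, rfl⟩
    rw [this]
    exact isOpen_iInter_of_finite fun m =>
      isOpen_Ioo.preimage (f := fun x : Plane => x m) (by fun_prop)
  · rintro k _ ⟨x, hx, rfl⟩ m
    have h1 := hx m
    have h2 := Φ.b_nonneg (e k) m
    have h3 := Φ.b_add_r_le (e k) m
    have h4 := Φ.r_pos (e k)
    simp only [system, coe_selfMap, map_apply, mem_Ioo] at *
    constructor <;> nlinarith
  · intro i j hij
    rw [eq_empty_iff_forall_notMem]
    rintro _ ⟨⟨x, hx, rfl⟩, ⟨y, hy, h⟩⟩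
    exact hij (e.injective (Φ.eq_of_interiors_meet _ _ _ _ hx hy
      (congrArg Subtype.val h).symm))

lemma map_injective (i : ι) : Function.Injective (Φ.map i) := by
  intro x y h
  have := Φ.dist_map i x y
  rw [h, dist_self] at this
  exact dist_eq_zero.1 ((mul_eq_zero.1 this.symm).resolve_left (Φ.r_pos i).ne')

lemma word_succ {X : Type*} [MetricSpace X] [CompactSpace X] (F : System X) (w : ℕ → ℕ) (n : ℕ)
    (x : X) : F.word w (n + 1) x = F.map (w 0) (F.word (fun k => w (k + 1)) n x) := by
  induction n generalizing x with
  | zero => rfl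
  | succ n ih =>
    change F.word w (n + 1) (F.map (w (n + 1)) x) = _
    rw [ih]
    rfl

/-- Since the maps are injective, undoing the first map of an address leaves a point addressed by
the shifted word, so the attractor is self-covered. Conversely, repeatedly choosing preimages inside
the limit set spells out an address. -/
lemma coe_image_attractor : Subtype.val '' (Φ.system e).attractor = Φ.limitSet := by
  set F := Φ.system e
  apply subset_antisymm
  · refine subset_sUnion_of_mem ⟨by rintro _ ⟨x, -, rfl⟩; exact x.2, ?_⟩
    rintro _ ⟨x, hx, rfl⟩
    obtain ⟨w, hw⟩ := mem_iUnion.1 hx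
    rw [mem_iInter] at hw
    obtain ⟨y, hy⟩ := hw 0
    refine mem_iUnion.2 ⟨e (w 0), y, ⟨y, ?_, rfl⟩, by rw [← hy]; rfl⟩
    refine mem_iUnion.2 ⟨fun k => w (k + 1), mem_iInter.2 fun n => ?_⟩
    obtain ⟨p, hp⟩ := hw (n + 1)
    refine ⟨p, ?_⟩
    rw [word_succ, ← hy] at hp
    exact Subtype.ext (Φ.map_injective _ (congrArg Subtype.val hp))
  · intro x hx
    have step : ∀ p : Φ.limitSet, ∃ k : ℕ, ∃ q : Φ.limitSet, Φ.map (e k) q = p := by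
      rintro ⟨p, hp⟩
      obtain ⟨i, q, hq, h⟩ := mem_iUnion.1 (Φ.limitSet_subset_iUnion hp)
      exact ⟨e.symm i, ⟨q, hq⟩, by simpa using h⟩
    choose k q hq using step
    -- A backward orbit of `x`; the maps used along it are the letters of an address of `x`.
    let z : ℕ → Φ.limitSet := fun n => q^[n] ⟨x, hx⟩
    have hz : ∀ n, Φ.map (e (k (z n))) (z (n + 1)) = z n := by
      intro n
      simp only [z, Function.iterate_succ_apply', hq]
    refine ⟨⟨x, Φ.limitSet_subset_unitSquare hx⟩, mem_iUnion.2 ⟨fun n => k (z n),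
      mem_iInter.2 fun n => ⟨⟨z (n + 1), Φ.limitSet_subset_unitSquare (z (n + 1)).2⟩, ?_⟩⟩, rfl⟩
    suffices H : ∀ n, F.word (fun n => k (z n)) n
        ⟨z n, Φ.limitSet_subset_unitSquare (z n).2⟩ = ⟨x, Φ.limitSet_subset_unitSquare hx⟩ from
      H (n + 1)
    intro n
    induction n with
    | zero => rfl
    | succ n ih =>
      rw [← ih]
      change F.word _ n (F.map _ _) = _
      congr 1
      exact Subtype.ext (hz n)

lemma isContinuum_attractor (h : IsClosed Φ.limitSet) (h' : IsConnected Φ.limitSet) :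
    IsContinuum (Φ.system e).attractor := by
  have hb : IsCompact Φ.limitSet := isCompact_of_isClosed_isBounded h
    (isBounded_unitSquare.subset Φ.limitSet_subset_unitSquare)
  rw [← Φ.coe_image_attractor e] at hb h'
  exact ⟨IsEmbedding.subtypeVal.isCompact_iff.2 hb,
    by simpa using h'.1, IsInducing.subtypeVal.isPreconnected_image.1 h'.2⟩

lemma isPathConnected_limitSet (h : IsPathConnected (Φ.system e).attractor) :
    IsPathConnected Φ.limitSet := by
  rw [← Φ.coe_image_attractor e]
  exact h.image continuous_subtype_val

lemma isCurveImage_attractor {f : I → Plane} (hf : Continuous f) (h : range f = Φ.limitSet) :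
    IsCurveImage (Φ.system e).attractor := by
  have hQ : ∀ t, f t ∈ unitSquare := fun t =>
    Φ.limitSet_subset_unitSquare (h ▸ mem_range_self t)
  refine ⟨fun t => ⟨f t, hQ t⟩, hf.subtype_mk _, ?_⟩
  apply Subtype.val_injective.image_injective
  rw [Φ.coe_image_attractor, ← h, ← range_comp]
  rfl

lemma exists_holder_of_isHolderCurveImage (h : IsHolderCurveImage (Φ.system e).attractor) :
    ∃ (C r : ℝ≥0) (f : I → Plane), 0 < r ∧ HolderWith C r f ∧ range f = Φ.limitSet := by
  obtain ⟨C, r, f, hr, hf, h⟩ := h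
  refine ⟨C, r, fun t => f t, hr, fun x y => hf x y, ?_⟩
  rw [← Φ.coe_image_attractor e, ← h, ← range_comp]
  rfl

lemma sdim_system_le (t : ℝ≥0) (h : ∑' i, ENNReal.ofReal (Φ.r i ^ (t : ℝ)) ≤ 1) :
    (Φ.system e).sdim ≤ t := by
  refine iInf₂_le_of_le t (le_trans (le_of_eq ?_) h) le_rfl
  rw [System.psi, ← e.tsum_eq (fun i => ENNReal.ofReal (Φ.r i ^ (t : ℝ)))]
  refine tsum_congr fun k => ?_
  have : lip ((Φ.system e).map k) = (Φ.r (e k)).toNNReal := Φ.lip_selfMap _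
  rw [this, ENNReal.ofReal, Real.toNNReal_rpow_of_nonneg (Φ.r_pos _).le]

end SquareFamily

/-! ### A self-similar loop as a fixed point -/

namespace Excursion

/-- A trapezoid with value `1` on `[1/3, 2/3]` and support `[0, 1]`. -/
def trapezoid (s : ℝ) : I := projIcc 0 1 zero_le_one (min (3 * s) (3 - 3 * s))

/-- A tent with peak `1` at `1/2` and support `[1/3, 2/3]`. -/
def tent (s : ℝ) : I := projIcc 0 1 zero_le_one (min (6 * s - 2) (4 - 6 * s))

lemma continuous_trapezoid : Continuous trapezoid := by
  unfold trapezoid; exact continuous_projIcc.comp (by fun_prop)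

lemma continuous_tent : Continuous tent := by
  unfold tent; exact continuous_projIcc.comp (by fun_prop)

lemma trapezoid_eq_zero {s : ℝ} (h : s ≤ 0 ∨ 1 ≤ s) : trapezoid s = 0 := by
  refine projIcc_of_le_left _ ?_
  rcases h with h | h
  · exact (min_le_left _ _).trans (by linarith)
  · exact (min_le_right _ _).trans (by linarith)

lemma trapezoid_eq_one {s : ℝ} (h : 1 / 3 ≤ s) (h' : s ≤ 2 / 3) : trapezoid s = 1 :=
  projIcc_of_right_le _ (le_min (by linarith) (by linarith))

lemma tent_eq_zero {s : ℝ} (h : s ≤ 1 / 3 ∨ 2 / 3 ≤ s) : tent s = 0 := by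
  refine projIcc_of_le_left _ ?_
  rcases h with h | h
  · exact (min_le_left _ _).trans (by linarith)
  · exact (min_le_right _ _).trans (by linarith)

lemma tent_rise (t : I) : tent (1 / 3 + t / 6) = t := by
  have := t.2.1
  have := t.2.2
  rw [tent, show min (6 * (1 / 3 + (t : ℝ) / 6) - 2) (4 - 6 * (1 / 3 + (t : ℝ) / 6)) = t by
    rw [min_eq_left (by linarith)]; ring]
  exact projIcc_val _ t

variable {E : Type*} [NormedAddCommGroup E] [NormedSpace ℝ E] {z : E} {w : ℕ → E}
  (q : ∀ n, Path z (w n)) (r : ℕ → ℝ) (f : C(I, E))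

/-- The displacement, during one unit of time, that follows `q n`, then a copy of `f` there and
back, then `q n` backwards. -/
def piece (n : ℕ) (s : ℝ) : E :=
  q n (trapezoid s) - z + r n • (f (tent s) - f 0)

lemma continuous_piece (n : ℕ) : Continuous (piece q r f n) := by
  have h1 := (q n).continuous.comp continuous_trapezoid
  have h2 := f.continuous.comp continuous_tent
  unfold piece
  exact (h1.sub continuous_const).add (continuous_const.smul (h2.sub continuous_const))

lemma piece_eq_zero (n : ℕ) {s : ℝ} (h : s ≤ 0 ∨ 1 ≤ s) : piece q r f n s = 0 := by
  have h' : s ≤ 1 / 3 ∨ 2 / 3 ≤ s := h.imp (fun h => by linarith) fun h => by linarith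
  rw [piece, trapezoid_eq_zero h, tent_eq_zero h']
  simp

/-- The concatenation of all the pieces, parametrized by the half line. -/
def ray (u : ℝ) : E := z + piece q r f ⌊u⌋₊ (u - ⌊u⌋₊)

/-- Each piece vanishes outside its own unit of time, so locally the concatenation is a finite sum
of continuous functions; this avoids gluing at the integers. -/
lemma ray_eq_sum {u : ℝ} {N : ℕ} (hu : u < N) :
    ray q r f u = z + ∑ n ∈ Finset.range N, piece q r f n (u - n) := by
  rw [ray, Finset.sum_eq_single ⌊u⌋₊]
  · intro n _ hn
    apply piece_eq_zero
    rcases lt_or_gt_of_ne hn with h | h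
    · right
      have h1 : n + 1 ≤ ⌊u⌋₊ := h
      have h2 : (⌊u⌋₊ : ℝ) ≤ u := Nat.floor_le (by
        by_contra hneg
        rw [Nat.floor_of_nonpos (not_le.1 hneg).le] at h1
        omega)
      have h3 : (n : ℝ) + 1 ≤ ⌊u⌋₊ := by exact_mod_cast h1
      linarith
    · left
      have := (Nat.floor_lt' (by omega)).1 h
      linarith
  · intro hN
    rcases le_or_gt u 0 with h0 | h0
    · exact piece_eq_zero _ _ _ _ (Or.inl (by simp only [Nat.floor_of_nonpos h0]; simpa))
    · exact absurd (Finset.mem_range.2 ((Nat.floor_lt h0.le).2 hu)) hN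

lemma continuous_ray : Continuous (ray q r f) := by
  rw [continuous_iff_continuousAt]
  intro u
  obtain ⟨N, hN⟩ := exists_nat_gt u
  have hc : Continuous fun u : ℝ => z + ∑ n ∈ Finset.range N, piece q r f n (u - n) :=
    continuous_const.add (continuous_finsetSum _ fun n _ =>
      (continuous_piece q r f n).comp (by fun_prop))
  refine hc.continuousAt.congr ?_
  filter_upwards [Iio_mem_nhds hN] with v hv
  exact (ray_eq_sum q r f hv).symm

variable {q r}

lemma tendsto_ray {d : ℕ → ℝ} (hd : Tendsto d atTop (𝓝 0)) (hr : Tendsto r atTop (𝓝 0))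
    (hq : ∀ n t, dist (q n t) z ≤ d n) : Tendsto (ray q r f) atTop (𝓝 z) := by
  have hb : Tendsto (fun n => d n + |r n| * (2 * ‖f‖)) atTop (𝓝 0) := by
    simpa using hd.add (hr.abs.mul_const (2 * ‖f‖))
  rw [tendsto_iff_dist_tendsto_zero]
  refine squeeze_zero (fun _ => dist_nonneg) (fun u => ?_)
    (hb.comp (tendsto_nat_floor_atTop (α := ℝ)))
  rw [ray, dist_eq_norm, add_sub_cancel_left, piece]
  refine (norm_add_le _ _).trans (add_le_add ?_ ?_)
  · rw [← dist_eq_norm]; exact hq _ _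
  · rw [norm_smul, Real.norm_eq_abs]
    gcongr
    refine (norm_sub_le _ _).trans ?_
    linarith [f.norm_coe_le_norm (tent (u - ⌊u⌋₊)), f.norm_coe_le_norm 0]

variable (q r)

/-- The concatenation of all the pieces, parametrized by the unit interval. -/
def loop (t : I) : E := if (t : ℝ) < 1 then ray q r f (t / (1 - t)) else z

lemma loop_one : loop q r f 1 = z := by simp [loop]

lemma loop_of_ray {u : ℝ} (hu : 0 ≤ u) : ∃ t : I, loop q r f t = ray q r f u := by
  have h1 : u / (1 + u) < 1 := by rw [div_lt_one (by linarith)]; linarith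
  refine ⟨⟨u / (1 + u), by positivity, h1.le⟩, ?_⟩
  have h2 : (1 : ℝ) - u / (1 + u) = 1 / (1 + u) := by field_simp; ring
  simp only [loop, h1, if_true, h2]
  congr 1
  field_simp

variable {q r}

lemma continuous_loop {d : ℕ → ℝ} (hd : Tendsto d atTop (𝓝 0)) (hr : Tendsto r atTop (𝓝 0))
    (hq : ∀ n t, dist (q n t) z ≤ d n) : Continuous (loop q r f) := by
  rw [continuous_iff_continuousAt]
  intro t
  have hcont : ContinuousOn (fun t : I => (t : ℝ) / (1 - t)) {t | (t : ℝ) < 1} := by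
    exact ContinuousOn.div (by fun_prop) (by fun_prop) fun t (ht : (t : ℝ) < 1) => by linarith
  have hopen : IsOpen {t : I | (t : ℝ) < 1} := isOpen_lt (by fun_prop) (by fun_prop)
  rcases lt_or_ge (t : ℝ) 1 with ht | ht
  · have hn := hopen.mem_nhds ht
    refine (((continuous_ray q r f).continuousAt.comp (hcont.continuousAt hn))).congr ?_
    filter_upwards [hn] with s (hs : (s : ℝ) < 1)
    simp [loop, hs]
  · have ht1 : t = 1 := Subtype.ext (le_antisymm t.2.2 ht)
    subst ht1
    rw [ContinuousAt, loop_one]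
    have hlim : Tendsto (fun t : I => (t : ℝ) / (1 - t)) (𝓝[{t | (t : ℝ) < 1}] 1) atTop := by
      have h1 : Tendsto (fun t : I => (t : ℝ)) (𝓝[{t | (t : ℝ) < 1}] 1) (𝓝 1) :=
        (continuous_subtype_val.tendsto (1 : I)).mono_left nhdsWithin_le_nhds
      have h2 : Tendsto (fun t : I => 1 - (t : ℝ)) (𝓝[{t | (t : ℝ) < 1}] 1) (𝓝[>] 0) := by
        refine tendsto_nhdsWithin_iff.2 ⟨by simpa using h1.const_sub 1, ?_⟩
        filter_upwards [self_mem_nhdsWithin] with s (hs : (s : ℝ) < 1)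
        simpa using hs
      simpa [div_eq_mul_inv] using
        h1.pos_mul_atTop zero_lt_one (tendsto_inv_nhdsGT_zero.comp h2)
    have hray := (tendsto_ray f hd hr hq).comp hlim
    intro U hU
    rw [mem_map]
    have h1 := mem_nhdsWithin_iff_eventually.1 (hray hU)
    filter_upwards [h1] with s hs
    by_cases h : (s : ℝ) < 1 <;> rw [mem_preimage]
    · simpa [loop, h] using hs h
    · simpa [loop, h] using mem_of_mem_nhds hU

lemma dist_loop_le {ρ : ℝ} (hρ : ∀ n, |r n| ≤ ρ) (f g : C(I, E)) (t : I) :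
    dist (loop q r f t) (loop q r g t) ≤ 2 * ρ * dist f g := by
  have hρ0 : 0 ≤ ρ := (abs_nonneg _).trans (hρ 0)
  by_cases h : (t : ℝ) < 1
  · simp only [loop, h, if_true, ray, piece, dist_add_left]
    rw [dist_eq_norm, ← smul_sub, norm_smul, Real.norm_eq_abs]
    set s := tent ((t : ℝ) / (1 - t) - ⌊(t : ℝ) / (1 - t)⌋₊)
    have h1 : ‖f s - f 0 - (g s - g 0)‖ ≤ 2 * dist f g := by
      rw [← dist_eq_norm]
      refine (dist_sub_sub_le _ _ _ _).trans ?_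
      linarith [ContinuousMap.dist_apply_le_dist (f := f) (g := g) s,
        ContinuousMap.dist_apply_le_dist (f := f) (g := g) 0]
    calc _ ≤ ρ * (2 * dist f g) := mul_le_mul (hρ _) h1 (norm_nonneg _) hρ0
      _ = _ := by ring
  · simp only [loop, h, if_false, dist_self]
    positivity

/-- The self-similar loop: it makes, around the hub `z`, one excursion for every `n`, at the far
end of which it runs through a copy of itself. -/
lemma exists_loop [CompleteSpace E] {d : ℕ → ℝ} (hd : Tendsto d atTop (𝓝 0))
    (hr : Tendsto r atTop (𝓝 0)) (hq : ∀ n t, dist (q n t) z ≤ d n) (hr4 : ∀ n, |r n| ≤ 1 / 4) :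
    ∃ f : C(I, E), ∀ t, loop q r f t = f t := by
  -- As `piece` uses `f - f 0`, the operator is defined on all continuous maps, without requiring `f
  -- 0 = z`. The price is a factor 2, and ratios of at most 1/4 still give the contraction constant
  -- 1/2.
  let T : C(I, E) → C(I, E) := fun f => ⟨loop q r f, continuous_loop f hd hr hq⟩
  have hT : ContractingWith (1 / 2) T := by
    refine ⟨by norm_num, LipschitzWith.of_dist_le_mul fun f g => ?_⟩
    refine (ContinuousMap.dist_le (by positivity)).2 fun t => ?_
    refine (dist_loop_le hr4 f g t).trans (le_of_eq ?_)
    push_cast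
    ring
  refine ⟨ContractingWith.fixedPoint T hT, fun t => ?_⟩
  exact DFunLike.congr_fun hT.fixedPoint_isFixedPt t

end Excursion

/-! ### Limit sets that are curves -/

namespace SquareFamily

open Excursion

/-- The limit set is a curve if all the images of a hub can be reached from the hub inside the
limit set, by paths that are short for all but finitely many indices. -/
lemma exists_curve {ι : Type*} (Φ : SquareFamily ι) (e : ℕ ≃ ι) (hK : IsClosed Φ.limitSet)
    {z : Plane} {d : ι → ℝ} (hd : Tendsto d cofinite (𝓝 0)) (hr : ∀ i, Φ.r i ≤ d i)
    (hz : ∀ i, JoinedIn (Φ.limitSet ∩ closedBall z (d i)) z (Φ.map i z)) :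
    ∃ f : I → Plane, Continuous f ∧ range f = Φ.limitSet := by
  have hzK : z ∈ Φ.limitSet := (hz (e 0)).source_mem.1
  have hd' : Tendsto (fun n => d (e n)) atTop (𝓝 0) := by
    rw [← Nat.cofinite_eq_atTop]
    exact hd.comp e.injective.tendsto_cofinite
  have hr' : Tendsto (fun n => Φ.r (e n)) atTop (𝓝 0) :=
    squeeze_zero (fun n => (Φ.r_pos _).le) (fun n => hr _) hd'
  let q : ∀ n, Path z (Φ.map (e n) z) := fun n => (hz (e n)).somePath
  have hq : ∀ n t, q n t ∈ Φ.limitSet ∩ closedBall z (d (e n)) :=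
    fun n t => (hz (e n)).somePath_mem t
  obtain ⟨f, hf⟩ := exists_loop (q := q) hd' hr' (fun n t => (hq n t).2) fun n => by
    rw [abs_of_pos (Φ.r_pos _)]; exact Φ.r_le _
  have hf0 : f 0 = z := by
    rw [← hf, loop, if_pos (by simp), ray, piece_eq_zero] <;> simp
  have hbdd : Bornology.IsBounded (range f) := (isCompact_range f.continuous).isBounded
  refine ⟨f, f.continuous, subset_antisymm ?_ ?_⟩
  -- In the outer thirds of a unit of time the loop follows a path in the limit set; in the middle
  -- third it lies in an image of its own range.
  · refine Φ.subset_of_subset_iUnion hbdd hK ⟨z, hzK⟩ (fun i x hx => Φ.map_mem_limitSet i hx) ?_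
    rintro _ ⟨t, rfl⟩
    rw [← hf, loop]
    split_ifs with h
    · rw [ray]
      set u : ℝ := t / (1 - t)
      set n := ⌊u⌋₊
      rcases le_total (u - n) (1 / 3) with h1 | h1
      · left
        rw [piece, tent_eq_zero (Or.inl h1)]
        simpa using (hq _ _).1
      rcases le_total (u - n) (2 / 3) with h2 | h2
      · right
        refine mem_iUnion.2 ⟨e n, f (tent (u - n)), mem_range_self _, ?_⟩
        rw [piece, trapezoid_eq_one h1 h2, Path.target, hf0]
        simp only [map, smul_sub]
        abel
      · left
        rw [piece, tent_eq_zero (Or.inr h2)]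
        simpa using (hq _ _).1
    · exact Or.inl hzK
  · refine Φ.subset_of_subset_iUnion
      (isBounded_unitSquare.subset Φ.limitSet_subset_unitSquare)
      (isCompact_range f.continuous).isClosed (range_nonempty f) ?_
      (Φ.limitSet_subset_iUnion.trans subset_union_right)
    rintro i _ ⟨t, rfl⟩
    obtain ⟨n, rfl⟩ := e.surjective i
    have ht0 := t.2.1
    have ht1 := t.2.2
    -- On the rising half of the tent, times 1/3 to 1/2 of excursion `n`, the loop runs through the
    -- image of `f` under map `e n`, so the range of `f` is invariant.
    obtain ⟨t', ht'⟩ := loop_of_ray q (fun n => Φ.r (e n)) f (u := n + (1 / 3 + t / 6))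
      (by positivity)
    refine ⟨t', ?_⟩
    have hfl : ⌊(n : ℝ) + (1 / 3 + t / 6)⌋₊ = n := by
      rw [Nat.floor_eq_iff (by positivity)]
      constructor <;> linarith
    rw [← hf, ht', ray, hfl, add_sub_cancel_left, piece, tent_rise,
      trapezoid_eq_one (by linarith) (by linarith), Path.target, hf0]
    simp only [map, smul_sub]
    abel

end SquareFamily

/-! ### Combs: the squares and their disjointness -/

/-- The parameters of a family of squares. In units of `1 / n`, the family consists of the
squares of the grid `n × n` in the left column, the bottom row, and column `3`, and, inside the
grid square `(2, 2)`, of a sequence of columns converging to column `3`: the `k`-th one is made of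
`N k` squares of size `2 ^ (-k) / 4`, and the right neighbour of its `c k`-th square is added. -/
structure Comb where
  n : ℕ
  five_le : 5 ≤ n
  N : ℕ → ℕ
  N_le : ∀ k, N k ≤ 3 * 2 ^ k
  c : ℕ → ℕ
  c_lt : ∀ k, c k < N k

namespace Comb

open IIFS

/-- The size of the squares of level `k`. -/
def size (k : ℕ) : ℝ := (1 / 4) * (1 / 2) ^ k

lemma size_pos (k : ℕ) : 0 < size k := by unfold size; positivity

lemma size_succ (k : ℕ) : size (k + 1) = size k / 2 := by unfold size; ring

lemma size_antitone : Antitone size := antitone_nat_of_succ_le fun k => by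
  rw [size_succ]; linarith [size_pos k]

lemma size_zero : size 0 = 1 / 4 := by norm_num [size]

lemma size_le (k : ℕ) : size k ≤ 1 / 4 := size_zero ▸ size_antitone (Nat.zero_le k)

lemma size_le_half {j k : ℕ} (h : j < k) : size k ≤ size j / 2 := by
  rw [← size_succ]; exact size_antitone h

lemma two_pow_mul_size (k : ℕ) : 2 ^ k * size k = 1 / 4 := by
  unfold size
  rw [one_div_pow]
  field_simp

lemma tendsto_size : Tendsto size atTop (𝓝 0) := by
  have := (tendsto_pow_atTop_nhds_zero_of_lt_one (by norm_num : (0:ℝ) ≤ 1 / 2)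
    (by norm_num)).const_mul (1 / 4)
  rwa [mul_zero] at this

variable (P : Comb)

/-- The grid squares of the family. -/
abbrev Grid : Type := {p : Fin P.n × Fin P.n // (p.1 : ℕ) = 0 ∨ (p.2 : ℕ) = 0 ∨ (p.1 : ℕ) = 3}

/-- The small squares of the family: `none` stands for the neighbour of a column. -/
abbrev Small : Type := Σ k, Option (Fin (P.N k))

/-- The index type of the family. -/
abbrev Idx : Type := P.Grid ⊕ P.Small

/-- The size, in units of `1 / n`. -/
def scale : P.Idx → ℝ := Sum.elim (fun _ => 1) fun w => size w.1

/-- The left end, in units of `1 / n`. -/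
def left : P.Idx → ℝ := Sum.elim (fun p => (p.1.1 : ℕ))
  fun w => 3 - 4 * size w.1 + w.2.elim (size w.1) fun _ => 0

/-- The lower end, in units of `1 / n`. -/
def bottom : P.Idx → ℝ := Sum.elim (fun p => (p.1.2 : ℕ))
  fun w => 2 + size w.1 * w.2.elim (P.c w.1 : ℝ) fun j => (j : ℕ)

/-- The point with the given coordinates, in units of `1 / n`. -/
def pt (x y : ℝ) : Plane := !₂[x / P.n, y / P.n]

@[simp] lemma pt_zero (x y : ℝ) : P.pt x y 0 = x / P.n := rfl

@[simp] lemma pt_one (x y : ℝ) : P.pt x y 1 = y / P.n := rfl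

lemma n_pos : (0 : ℝ) < P.n := by
  have := P.five_le
  positivity

lemma five_le' : (5 : ℝ) ≤ P.n := by exact_mod_cast P.five_le

lemma ext_plane {p q : Plane} (h0 : p 0 = q 0) (h1 : p 1 = q 1) : p = q := by
  ext m; fin_cases m <;> assumption

lemma eq_pt (p : Plane) : p = P.pt (P.n * p 0) (P.n * p 1) := by
  have := P.n_pos
  apply ext_plane <;> simp <;> field_simp

lemma N_mul_size_le (k : ℕ) : P.N k * size k ≤ 3 / 4 := by
  have h1 : (P.N k : ℝ) ≤ 3 * 2 ^ k := by exact_mod_cast P.N_le k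
  have h2 := two_pow_mul_size k
  nlinarith [size_pos k]

lemma height_le (k : ℕ) {j : ℕ} (h : j < P.N k) :
    size k * j + size k ≤ P.N k * size k := by
  have h1 : (j : ℝ) + 1 ≤ P.N k := by exact_mod_cast h
  nlinarith [size_pos k]

lemma scale_pos (i : P.Idx) : 0 < P.scale i := by
  rcases i with p | w
  · simp [scale]
  · exact size_pos _

lemma scale_le (i : P.Idx) : P.scale i ≤ 1 := by
  rcases i with p | w
  · simp [scale]
  · exact (size_le _).trans (by norm_num)

lemma small_bounds (w : P.Small) :
    3 - 4 * size w.1 ≤ P.left (.inr w) ∧ P.left (.inr w) + size w.1 ≤ 3 - 2 * size w.1 ∧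
      2 ≤ P.bottom (.inr w) ∧ P.bottom (.inr w) + size w.1 ≤ 2 + P.N w.1 * size w.1 := by
  obtain ⟨k, _ | j⟩ := w
  · have := size_pos k
    have := P.height_le k (P.c_lt k)
    simp only [left, bottom, Sum.elim_inr, Option.elim]
    refine ⟨by linarith, by linarith, le_add_of_nonneg_right (by positivity), by linarith⟩
  · have := size_pos k
    have := P.height_le k j.2
    simp only [left, bottom, Sum.elim_inr, Option.elim]
    refine ⟨by linarith, by linarith, le_add_of_nonneg_right (by positivity), by linarith⟩

lemma left_nonneg (i : P.Idx) : 0 ≤ P.left i := by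
  rcases i with p | w
  · simp [left]
  · have := P.small_bounds w
    have := size_le w.1
    linarith

lemma bottom_nonneg (i : P.Idx) : 0 ≤ P.bottom i := by
  rcases i with p | w
  · simp [bottom]
  · have := P.small_bounds w
    linarith

lemma left_add_le (i : P.Idx) : P.left i + P.scale i ≤ P.n := by
  rcases i with p | w
  · have : ((p.1.1 : ℕ) : ℝ) + 1 ≤ P.n := by exact_mod_cast p.1.1.2
    simpa [left, scale] using this
  · have := P.small_bounds w
    have := size_pos w.1
    have := P.five_le'
    simp only [scale, Sum.elim_inr]
    linarith

lemma bottom_add_le (i : P.Idx) : P.bottom i + P.scale i ≤ P.n := by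
  rcases i with p | w
  · have : ((p.1.2 : ℕ) : ℝ) + 1 ≤ P.n := by exact_mod_cast p.1.2.2
    simpa [bottom, scale] using this
  · have := P.small_bounds w
    have := P.N_mul_size_le w.1
    have := P.five_le'
    simp only [scale, Sum.elim_inr]
    linarith

lemma grid_ne_small (p : P.Grid) (w : P.Small) {u v : Plane} (hu : ∀ m, u m ∈ Ioo (0 : ℝ) 1)
    (hv : ∀ m, v m ∈ Ioo (0 : ℝ) 1)
    (h0 : P.left (.inl p) + P.scale (.inl p) * u 0 = P.left (.inr w) + P.scale (.inr w) * v 0)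
    (h1 : P.bottom (.inl p) + P.scale (.inl p) * u 1 =
      P.bottom (.inr w) + P.scale (.inr w) * v 1) : False := by
  obtain ⟨b1, b2, b3, b4⟩ := P.small_bounds w
  have hs := size_pos w.1
  have hs' := size_le w.1
  obtain ⟨u0, u0'⟩ := hu 0
  obtain ⟨u1, u1'⟩ := hu 1
  obtain ⟨v0, v0'⟩ := hv 0
  obtain ⟨v1, v1'⟩ := hv 1
  rw [show P.scale (.inl p) = 1 from rfl, show P.scale (.inr w) = size w.1 from rfl] at *
  have e0 : size w.1 * v 0 < size w.1 := by nlinarith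
  have e0' : 0 < size w.1 * v 0 := by positivity
  have e1' : 0 < size w.1 * v 1 := by positivity
  rcases p.2 with h | h | h
  · have : P.left (.inl p) = 0 := by simp [left, h]
    linarith
  · have : P.bottom (.inl p) = 0 := by simp [bottom, h]
    linarith
  · have : P.left (.inl p) = 3 := by simp [left, h]
    linarith

lemma nat_eq_of_add_eq {a b : ℕ} {s u v : ℝ} (hs : 0 < s) (hu : u ∈ Ioo (0 : ℝ) 1)
    (hv : v ∈ Ioo (0 : ℝ) 1) (h : s * a + s * u = s * b + s * v) : a = b := by
  have h' : (a : ℝ) + u = b + v := by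
    have : s * (a + u) = s * (b + v) := by linarith
    exact mul_left_cancel₀ hs.ne' this
  have h1 : (a : ℝ) < b + 1 := by linarith [hu.1, hv.2]
  have h2 : (b : ℝ) < a + 1 := by linarith [hv.1, hu.2]
  have h3 : a < b + 1 := by exact_mod_cast h1
  have h4 : b < a + 1 := by exact_mod_cast h2
  omega

/-- Level k lies over the interval from 3 - 4 `size k` to 3 - 2 `size k`, and the right end is where
level k + 1 starts. -/
lemma level_le (w w' : P.Small) {u v : ℝ} (hu : u ∈ Ioo (0 : ℝ) 1)
    (hv : v ∈ Ioo (0 : ℝ) 1)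
    (h0 : P.left (.inr w) + P.scale (.inr w) * u = P.left (.inr w') + P.scale (.inr w') * v) :
    w'.1 ≤ w.1 := by
  by_contra! hlt
  obtain ⟨b1, b2, -, -⟩ := P.small_bounds w
  obtain ⟨b1', b2', -, -⟩ := P.small_bounds w'
  have hs := size_pos w.1
  have hs' := size_pos w'.1
  have hh := size_le_half hlt
  have e0 : size w.1 * u < size w.1 := by nlinarith [hu.1, hu.2]
  have e1 : 0 < size w'.1 * v := mul_pos hs' hv.1
  simp only [scale, Sum.elim_inr] at h0
  linarith

lemma small_eq (w w' : P.Small) {u v : Plane} (hu : ∀ m, u m ∈ Ioo (0 : ℝ) 1)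
    (hv : ∀ m, v m ∈ Ioo (0 : ℝ) 1)
    (h0 : P.left (.inr w) + P.scale (.inr w) * u 0 = P.left (.inr w') + P.scale (.inr w') * v 0)
    (h1 : P.bottom (.inr w) + P.scale (.inr w) * u 1 =
      P.bottom (.inr w') + P.scale (.inr w') * v 1) : w = w' := by
  have hk := le_antisymm (P.level_le w' w (hv 0) (hu 0) h0.symm) (P.level_le w w' (hu 0) (hv 0) h0)
  obtain ⟨k, o⟩ := w
  obtain ⟨k', o'⟩ := w'
  obtain rfl : k = k' := hk
  have hs := size_pos k
  obtain ⟨u0, u0'⟩ := hu 0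
  obtain ⟨v0, v0'⟩ := hv 0
  have e1 : 0 < size k * u 0 := by positivity
  have e1' : size k * u 0 < size k := by nlinarith
  have e2 : 0 < size k * v 0 := by positivity
  have e2' : size k * v 0 < size k := by nlinarith
  rcases o with _ | j <;> rcases o' with _ | j' <;>
    simp only [left, bottom, scale, Sum.elim_inr, Option.elim] at h0 h1
  · rfl
  · linarith
  · linarith
  · have := nat_eq_of_add_eq hs (hu 1) (hv 1) (by linarith : size k * (j : ℕ) + size k * u 1 = _)
    rw [Fin.ext this]

/-- The family of squares. -/
def family : SquareFamily P.Idx where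
  r i := P.scale i / P.n
  b i := P.pt (P.left i) (P.bottom i)
  r_pos i := div_pos (P.scale_pos i) P.n_pos
  r_le i := by
    rw [div_le_iff₀ P.n_pos]
    linarith [P.scale_le i, P.five_le']
  b_nonneg i m := by
    have := P.n_pos
    have := P.left_nonneg i
    have := P.bottom_nonneg i
    fin_cases m
    · change 0 ≤ P.left i / P.n; positivity
    · change 0 ≤ P.bottom i / P.n; positivity
  b_add_r_le i m := by
    have hn := P.n_pos
    fin_cases m
    · change P.left i / P.n + P.scale i / P.n ≤ 1
      rw [← add_div, div_le_one hn]
      exact P.left_add_le i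
    · change P.bottom i / P.n + P.scale i / P.n ≤ 1
      rw [← add_div, div_le_one hn]
      exact P.bottom_add_le i
  eq_of_interiors_meet i j u v hu hv h := by
    have hn := P.n_pos
    have h0 : P.left i + P.scale i * u 0 = P.left j + P.scale j * v 0 := by
      have := congrArg (fun p : Plane => p 0 * P.n) h
      simp only [PiLp.add_apply, PiLp.smul_apply, pt_zero, smul_eq_mul] at this
      field_simp at this
      linarith
    have h1 : P.bottom i + P.scale i * u 1 = P.bottom j + P.scale j * v 1 := by
      have := congrArg (fun p : Plane => p 1 * P.n) h
      simp only [PiLp.add_apply, PiLp.smul_apply, pt_one, smul_eq_mul] at this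
      field_simp at this
      linarith
    rcases i with p | w <;> rcases j with p' | w'
    · have e0 := nat_eq_of_add_eq one_pos (hu 0) (hv 0)
        (by simpa [left, scale] using h0 : 1 * ((p.1.1 : ℕ) : ℝ) + _ = 1 * ((p'.1.1 : ℕ) : ℝ) + _)
      have e1 := nat_eq_of_add_eq one_pos (hu 1) (hv 1)
        (by simpa [bottom, scale] using h1 : 1 * ((p.1.2 : ℕ) : ℝ) + _ = 1 * ((p'.1.2 : ℕ) : ℝ) + _)
      rw [Subtype.ext (Prod.ext (Fin.ext e0) (Fin.ext e1))]
    · exact (P.grid_ne_small p w' hu hv h0 h1).elim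
    · exact (P.grid_ne_small p' w hv hu h0.symm h1.symm).elim
    · rw [P.small_eq w w' hu hv h0 h1]

lemma family_map (i : P.Idx) (x : Plane) : P.family.map i x =
    P.pt (P.left i + P.scale i * x 0) (P.bottom i + P.scale i * x 1) := by
  have := P.n_pos
  apply ext_plane <;> simp [family, add_div, div_mul_eq_mul_div]

lemma family_b (i : P.Idx) : P.family.b i = P.pt (P.left i) (P.bottom i) := rfl

/-! ### Segments in the attractor of a comb, and its closedness -/

/-- The limit set of the family. -/
def attractor : Set Plane := P.family.limitSet

lemma pt_mem_unitSquare {x y : ℝ} (hx : x ∈ Icc (0 : ℝ) P.n) (hy : y ∈ Icc (0 : ℝ) P.n) :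
    P.pt x y ∈ unitSquare := by
  have hn := P.n_pos
  intro m
  fin_cases m
  · exact ⟨div_nonneg hx.1 hn.le, (div_le_one hn).2 hx.2⟩
  · exact ⟨div_nonneg hy.1 hn.le, (div_le_one hn).2 hy.2⟩

lemma exists_grid (y : ℝ) (hy : y ∈ Icc (0 : ℝ) P.n) :
    ∃ j : Fin P.n, ∃ v ∈ Icc (0 : ℝ) 1, y = (j : ℕ) + v := by
  have hn := P.five_le
  rcases hy.2.lt_or_eq with h | h
  · refine ⟨⟨⌊y⌋₊, (Nat.floor_lt hy.1).2 h⟩, y - ⌊y⌋₊, ⟨?_, ?_⟩, by simp⟩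
    · linarith [Nat.floor_le hy.1]
    · linarith [Nat.lt_floor_add_one y]
  · refine ⟨⟨P.n - 1, by omega⟩, 1, by simp, ?_⟩
    rw [h]
    push_cast [show 1 ≤ P.n by omega]
    ring

/-- The two edges are covered by their own images under the squares of the left column and the
bottom row, so coinduction applies. -/
lemma edges_subset : {p | p ∈ unitSquare ∧ (p 0 = 0 ∨ p 1 = 0)} ⊆ P.attractor := by
  have hn := P.n_pos
  have hn5 := P.five_le
  refine P.family.subset_limitSet (fun p hp => hp.1) ?_
  rintro p ⟨hp, h⟩
  right
  have hscale : ∀ m, (P.n : ℝ) * p m ∈ Icc (0 : ℝ) P.n := fun m =>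
    ⟨mul_nonneg hn.le (hp m).1, mul_le_of_le_one_right hn.le (hp m).2⟩
  rcases h with h | h
  · obtain ⟨j, v, hv, hj⟩ := P.exists_grid _ (hscale 1)
    refine mem_iUnion.2 ⟨.inl ⟨(⟨0, by omega⟩, j), Or.inl rfl⟩, !₂[0, v], ⟨?_, Or.inl rfl⟩, ?_⟩
    · intro m; fin_cases m
      · simp
      · exact hv
    · rw [family_map, P.eq_pt p, hj, h]
      simp [left, bottom, scale]
  · obtain ⟨j, v, hv, hj⟩ := P.exists_grid _ (hscale 0)
    refine mem_iUnion.2 ⟨.inl ⟨(j, ⟨0, by omega⟩), Or.inr (Or.inl rfl)⟩, !₂[v, 0],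
      ⟨?_, Or.inr rfl⟩, ?_⟩
    · intro m; fin_cases m
      · exact hv
      · simp
    · rw [family_map, P.eq_pt p, hj, h]
      simp [left, bottom, scale]

lemma left_edge_mem (i : P.Idx) {v : ℝ} (hv : v ∈ Icc (0 : ℝ) 1) :
    P.pt (P.left i) (P.bottom i + P.scale i * v) ∈ P.attractor := by
  have := P.family.map_mem_limitSet i (P.edges_subset (a := !₂[0, v]) ⟨?_, Or.inl rfl⟩)
  · simpa [family_map, attractor] using this
  · intro m; fin_cases m
    · simp
    · exact hv

lemma bottom_edge_mem (i : P.Idx) {v : ℝ} (hv : v ∈ Icc (0 : ℝ) 1) :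
    P.pt (P.left i + P.scale i * v) (P.bottom i) ∈ P.attractor := by
  have := P.family.map_mem_limitSet i (P.edges_subset (a := !₂[v, 0]) ⟨?_, Or.inr rfl⟩)
  · simpa [family_map, attractor] using this
  · intro m; fin_cases m
    · exact hv
    · simp

lemma pt_zero_mem {y : ℝ} (hy : y ∈ Icc (0 : ℝ) P.n) : P.pt 0 y ∈ P.attractor :=
  P.edges_subset ⟨P.pt_mem_unitSquare ⟨le_rfl, P.n_pos.le⟩ hy, Or.inl (by simp)⟩

lemma pt_mem_zero {x : ℝ} (hx : x ∈ Icc (0 : ℝ) P.n) : P.pt x 0 ∈ P.attractor :=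
  P.edges_subset ⟨P.pt_mem_unitSquare hx ⟨le_rfl, P.n_pos.le⟩, Or.inr (by simp)⟩

lemma pt_three_mem {y : ℝ} (hy : y ∈ Icc (0 : ℝ) P.n) : P.pt 3 y ∈ P.attractor := by
  have hn5 := P.five_le
  obtain ⟨j, v, hv, rfl⟩ := P.exists_grid y hy
  simpa [left, bottom, scale] using
    P.left_edge_mem (.inl ⟨(⟨3, by omega⟩, j), Or.inr (Or.inr rfl)⟩) hv

lemma column_mem (k : ℕ) {y : ℝ} (hy : y ∈ Icc 0 (P.N k * size k)) :
    P.pt (3 - 4 * size k) (2 + y) ∈ P.attractor := by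
  have hs := size_pos k
  have hNpos : 0 < P.N k := (Nat.zero_le _).trans_lt (P.c_lt k)
  have hy0 : 0 ≤ y / size k := div_nonneg hy.1 hs.le
  obtain ⟨j, hj, v, hv, h⟩ : ∃ j < P.N k, ∃ v ∈ Icc (0 : ℝ) 1, y = size k * j + size k * v := by
    rcases hy.2.lt_or_eq with h | h
    · refine ⟨⌊y / size k⌋₊, ?_, y / size k - ⌊y / size k⌋₊, ⟨?_, ?_⟩, ?_⟩
      · rw [Nat.floor_lt hy0, div_lt_iff₀ hs]; exact h
      · linarith [Nat.floor_le hy0]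
      · linarith [Nat.lt_floor_add_one (y / size k)]
      · field_simp; ring
    · refine ⟨P.N k - 1, by omega, 1, by simp, ?_⟩
      rw [h]
      push_cast [show 1 ≤ P.N k by omega]
      ring
  have := P.left_edge_mem (.inr ⟨k, some ⟨j, hj⟩⟩) hv
  simpa [left, bottom, scale, h, add_assoc] using this

lemma row_mem (k : ℕ) {x : ℝ} (hx : x ∈ Icc 0 (2 * size k)) :
    P.pt (3 - 4 * size k + x) (2 + size k * P.c k) ∈ P.attractor := by
  have hs := size_pos k
  rcases le_total x (size k) with h | h
  · have := P.bottom_edge_mem (.inr ⟨k, some ⟨P.c k, P.c_lt k⟩⟩) (v := x / size k)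
      ⟨div_nonneg hx.1 hs.le, (div_le_one hs).2 h⟩
    simpa [left, bottom, scale, mul_div_cancel₀ _ hs.ne'] using this
  · have := P.bottom_edge_mem (.inr ⟨k, none⟩) (v := (x - size k) / size k)
      ⟨div_nonneg (by linarith) hs.le, (div_le_one hs).2 (by linarith [hx.2])⟩
    simpa [left, bottom, scale, mul_div_cancel₀ _ hs.ne', add_assoc] using this

lemma exists_square {p : Plane} (hp : p ∈ P.attractor) : ∃ i,
    P.n * p 0 ∈ Icc (P.left i) (P.left i + P.scale i) ∧
    P.n * p 1 ∈ Icc (P.bottom i) (P.bottom i + P.scale i) := by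
  have hn := P.n_pos
  obtain ⟨i, q, hq, rfl⟩ := mem_iUnion.1 (P.family.limitSet_subset_iUnion hp)
  have h0 := P.family.limitSet_subset_unitSquare hq 0
  have h1 := P.family.limitSet_subset_unitSquare hq 1
  have hs := P.scale_pos i
  refine ⟨i, ?_⟩
  rw [family_map, pt_zero, pt_one, mul_div_cancel₀ _ hn.ne', mul_div_cancel₀ _ hn.ne']
  refine ⟨⟨?_, ?_⟩, ?_, ?_⟩ <;> nlinarith [h0.1, h0.2, h1.1, h1.2]

lemma eventually_small (k₀ : ℕ) :
    ∀ᶠ i : P.Idx in cofinite, ∃ w : P.Small, i = .inr w ∧ k₀ ≤ w.1 := by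
  rw [eventually_cofinite]
  have h1 : (Set.range (Sum.inl : P.Grid → P.Idx)).Finite := finite_range _
  have h2 : (⋃ k ∈ Finset.range k₀,
      Set.range fun o : Option (Fin (P.N k)) => (Sum.inr ⟨k, o⟩ : P.Idx)).Finite :=
    Set.Finite.biUnion (Finset.finite_toSet _) fun k _ => finite_range _
  refine (h1.union h2).subset ?_
  rintro (p | ⟨k, o⟩) h
  · exact Or.inl ⟨p, rfl⟩
  · right
    have : k < k₀ := by
      by_contra hk
      exact h ⟨_, rfl, not_lt.1 hk⟩
    exact mem_biUnion (Finset.mem_coe.2 (Finset.mem_range.2 this)) ⟨o, rfl⟩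

/-- A point off the attractor is off the line x = 3, because the left edges of column 3 cover that
line within the square. Away from the line only finitely many levels are met. -/
lemma isClosed_attractor : IsClosed P.attractor := by
  have hn := P.n_pos
  refine P.family.isClosed_limitSet fun p hpQ hp => ?_
  have hp3 : P.n * p 0 ≠ 3 := fun h => hp (by
    rw [P.eq_pt p, h]
    exact P.pt_three_mem ⟨mul_nonneg hn.le (hpQ 1).1, mul_le_of_le_one_right hn.le (hpQ 1).2⟩)
  obtain ⟨k₀, hk₀⟩ : ∃ k, P.n * p 0 < 3 - 4 * size k ∨ 3 < P.n * p 0 := by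
    rcases hp3.lt_or_gt with h | h
    · have : Tendsto (fun k => 3 - 4 * size k) atTop (𝓝 3) := by
        simpa using (tendsto_size.const_mul 4).const_sub 3
      obtain ⟨k, hk⟩ := (this.eventually (lt_mem_nhds h)).exists
      exact ⟨k, Or.inl hk⟩
    · exact ⟨0, Or.inr h⟩
  have hopen : IsOpen {q : Plane | P.n * q 0 < 3 - 4 * size k₀ ∨ 3 < P.n * q 0} :=
    (isOpen_lt (f := fun q : Plane => P.n * q 0) (by fun_prop) continuous_const).union
      (isOpen_lt (g := fun q : Plane => P.n * q 0) continuous_const (by fun_prop))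
  refine ⟨_, hopen.mem_nhds hk₀, ?_⟩
  refine (eventually_cofinite.1 (P.eventually_small k₀)).subset ?_
  rintro i ⟨_, ⟨q, hq, rfl⟩, hU⟩ ⟨w, rfl, hw⟩
  obtain ⟨b1, b2, -, -⟩ := P.small_bounds w
  have hs := size_pos w.1
  have ha := size_antitone hw
  have h0 := hq 0
  rw [mem_ofPred_eq, family_map, pt_zero, mul_div_cancel₀ _ hn.ne'] at hU
  simp only [scale, Sum.elim_inr] at hU
  have e1 : 0 ≤ size w.1 * q 0 := mul_nonneg hs.le h0.1
  have e2 : size w.1 * q 0 ≤ size w.1 := mul_le_of_le_one_right hs.le h0.2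
  rcases hU with hU | hU <;> linarith

lemma joinedIn_vertical {A : Set Plane} {x y y' : ℝ}
    (h : ∀ v ∈ uIcc y y', P.pt x v ∈ A) : JoinedIn A (P.pt x y) (P.pt x y') := by
  refine JoinedIn.of_segment_subset ?_
  rintro _ ⟨a, b, ha, hb, hab, rfl⟩
  convert h (a * y + b * y') ?_ using 1
  · have ha : a = 1 - b := by linarith
    subst ha
    apply ext_plane <;> simp <;> ring
  · rw [← segment_eq_uIcc]
    exact ⟨a, b, ha, hb, hab, rfl⟩

lemma joinedIn_horizontal {A : Set Plane} {x x' y : ℝ}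
    (h : ∀ u ∈ uIcc x x', P.pt u y ∈ A) : JoinedIn A (P.pt x y) (P.pt x' y) := by
  refine JoinedIn.of_segment_subset ?_
  rintro _ ⟨a, b, ha, hb, hab, rfl⟩
  convert h (a * x + b * x') ?_ using 1
  · have ha : a = 1 - b := by linarith
    subst ha
    apply ext_plane <;> simp <;> ring
  · rw [← segment_eq_uIcc]
    exact ⟨a, b, ha, hb, hab, rfl⟩

lemma origin_eq : (0 : Plane) = P.pt 0 0 := by
  apply ext_plane <;> simp

lemma joinedIn_origin_three {y : ℝ} (hy : y ∈ Icc (0 : ℝ) P.n) :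
    JoinedIn P.attractor 0 (P.pt 3 y) := by
  have hn := P.five_le'
  rw [P.origin_eq]
  refine (P.joinedIn_horizontal (x' := 3) fun u hu => P.pt_mem_zero ?_).trans
    (P.joinedIn_vertical fun v hv => P.pt_three_mem ?_)
  · rw [uIcc_of_le (by norm_num)] at hu
    exact ⟨hu.1, hu.2.trans (by linarith)⟩
  · rw [uIcc_of_le hy.1] at hv
    exact ⟨hv.1, hv.2.trans hy.2⟩

lemma joinedIn_origin_grid (p : P.Grid) :
    JoinedIn P.attractor 0 (P.family.b (.inl p)) := by
  have h0 : ((p.1.1 : ℕ) : ℝ) ∈ Icc (0 : ℝ) P.n :=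
    ⟨by positivity, by exact_mod_cast p.1.1.2.le⟩
  have h1 : ((p.1.2 : ℕ) : ℝ) ∈ Icc (0 : ℝ) P.n :=
    ⟨by positivity, by exact_mod_cast p.1.2.2.le⟩
  simp only [family_b, left, bottom, Sum.elim_inl]
  rcases p.2 with h | h | h
  · rw [h, P.origin_eq, Nat.cast_zero]
    refine P.joinedIn_vertical fun v hv => P.pt_zero_mem ?_
    rw [uIcc_of_le h1.1] at hv
    exact ⟨hv.1, hv.2.trans h1.2⟩
  · rw [h, P.origin_eq, Nat.cast_zero]
    refine P.joinedIn_horizontal fun v hv => P.pt_mem_zero ?_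
    rw [uIcc_of_le h0.1] at hv
    exact ⟨hv.1, hv.2.trans h0.2⟩
  · rw [h]
    exact P.joinedIn_origin_three h1

/-- A rectangle, in units of `1 / n`, that contains the squares of level `k`. -/
def box (k : ℕ) : Set Plane :=
  {p | P.n * p 0 ∈ Icc (3 - 4 * size k) 3 ∧ P.n * p 1 ∈ Icc 2 (2 + P.N k * size k)}

lemma pt_mem_box {k : ℕ} {x y : ℝ} :
    P.pt x y ∈ P.box k ↔ x ∈ Icc (3 - 4 * size k) 3 ∧ y ∈ Icc 2 (2 + P.N k * size k) := by
  have hn := P.n_pos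
  rw [box, mem_ofPred_eq, pt_zero, pt_one, mul_div_cancel₀ _ hn.ne', mul_div_cancel₀ _ hn.ne']

lemma joinedIn_foot (k : ℕ) {y : ℝ} (hy : y ∈ Icc 0 (P.N k * size k)) :
    JoinedIn (P.attractor ∩ P.box k) (P.pt (3 - 4 * size k) 2) (P.pt (3 - 4 * size k) (2 + y)) := by
  have hs := size_pos k
  refine P.joinedIn_vertical fun v hv => ?_
  rw [uIcc_of_le (by linarith [hy.1])] at hv
  have := P.column_mem k (y := v - 2) ⟨by linarith [hv.1], by linarith [hv.2, hy.2]⟩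
  rw [add_sub_cancel] at this
  exact ⟨this, P.pt_mem_box.2 ⟨⟨le_rfl, by linarith⟩, hv.1, by linarith [hv.2, hy.2]⟩⟩

lemma c_mem (k : ℕ) : size k * P.c k ∈ Icc 0 (P.N k * size k) := by
  have := P.height_le k (P.c_lt k)
  have := size_pos k
  exact ⟨by positivity, by linarith⟩

lemma joinedIn_foot_row (k : ℕ) {x : ℝ} (hx : x ∈ Icc 0 (2 * size k)) :
    JoinedIn (P.attractor ∩ P.box k) (P.pt (3 - 4 * size k) 2)
      (P.pt (3 - 4 * size k + x) (2 + size k * P.c k)) := by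
  have hs := size_pos k
  have hc := P.c_mem k
  refine (P.joinedIn_foot k hc).trans (P.joinedIn_horizontal fun u hu => ?_)
  rw [uIcc_of_le (by linarith [hx.1])] at hu
  have := P.row_mem k (x := u - (3 - 4 * size k)) ⟨by linarith [hu.1], by linarith [hu.2, hx.2]⟩
  rw [add_sub_cancel] at this
  exact ⟨this, P.pt_mem_box.2 ⟨⟨hu.1, by linarith [hu.2, hx.2]⟩, by linarith [hc.1],
    by linarith [hc.2]⟩⟩

lemma joinedIn_foot_small (w : P.Small) :
    JoinedIn (P.attractor ∩ P.box w.1) (P.pt (3 - 4 * size w.1) 2) (P.family.b (.inr w)) := by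
  obtain ⟨k, _ | j⟩ := w
  · have hs := size_pos k
    simpa [family_b, left, bottom] using
      P.joinedIn_foot_row k (x := size k) ⟨hs.le, by linarith⟩
  · have hs := size_pos k
    have := P.height_le k j.2
    simpa [family_b, left, bottom] using
      P.joinedIn_foot k (y := size k * (j : ℕ)) ⟨by positivity, by linarith⟩

/-- To the right of the left column and above the bottom row, the part of the attractor to the left
of column `3` consists of the small squares. -/
lemma exists_small_square {p : Plane} (hp : p ∈ P.attractor) (h0 : 1 < P.n * p 0)
    (h0' : P.n * p 0 < 3) (h1 : 1 < P.n * p 1) : ∃ w : P.Small,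
    P.n * p 0 ∈ Icc (P.left (.inr w)) (P.left (.inr w) + size w.1) ∧
    P.n * p 1 ∈ Icc (P.bottom (.inr w)) (P.bottom (.inr w) + size w.1) := by
  obtain ⟨i, hi, hi'⟩ := P.exists_square hp
  rcases i with q | w
  · exfalso
    rcases q.2 with h | h | h <;> simp [left, bottom, scale, h] at hi hi' <;> linarith
  · exact ⟨w, hi, hi'⟩

/-- On the vertical line through the middle of the square to the right of the `k`-th column, the
attractor lies in this square or in the bottom row. -/
lemma mem_of_gap {p : Plane} (hp : p ∈ P.attractor) {k : ℕ}
    (h0 : P.n * p 0 = 3 - 5 / 2 * size k) :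
    P.n * p 1 ≤ 1 ∨
      P.n * p 1 ∈ Icc (2 + size k * P.c k) (2 + size k * P.c k + size k) := by
  refine (le_or_gt _ 1).imp_right fun h1 => ?_
  have hs := size_pos k
  have hs' := size_le k
  obtain ⟨w, hw, hw'⟩ := P.exists_small_square hp (by linarith) (by linarith) h1
  obtain ⟨b1, b2, -, -⟩ := P.small_bounds w
  -- Earlier levels end to the left of this line and later ones start to its right. In level k the
  -- column itself ends at 3 - 3 `size k`, which leaves only the link.
  have hk : w.1 = k := by
    rcases lt_trichotomy w.1 k with h | h | h
    · linarith [hw.2, size_le_half h]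
    · exact h
    · linarith [hw.1, size_le_half h]
  obtain ⟨k', _ | j⟩ := w
  · obtain rfl : k' = k := hk
    simpa [bottom] using hw'
  · obtain rfl : k' = k := hk
    simp only [left, Sum.elim_inr, Option.elim] at hw
    linarith [hw.2]

end Comb

/-! ### Similarity dimension -/

namespace Comb

open IIFS

variable (P : Comb)

lemma card_grid_le : Fintype.card P.Grid ≤ 3 * P.n := by
  let g : P.Grid → Fin 3 × Fin P.n := fun p =>
    if (p.1.1 : ℕ) = 0 then (0, p.1.2) else if (p.1.2 : ℕ) = 0 then (1, p.1.1) else (2, p.1.2)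
  have hg : Function.Injective g := by
    rintro ⟨⟨a, b⟩, h⟩ ⟨⟨a', b'⟩, h'⟩ heq
    simp only [g] at heq
    simp only [Subtype.mk.injEq, Prod.mk.injEq, Fin.ext_iff]
    split_ifs at heq <;> simp [Fin.ext_iff] at heq h h' <;> omega
  simpa using Fintype.card_le_of_injective g hg

lemma tsum_grid_le (e : ℝ) : ∑' p : P.Grid, ENNReal.ofReal (P.family.r (.inl p) ^ (1 + e)) ≤
    ENNReal.ofReal (3 * (P.n : ℝ) ^ (-e)) := by
  have hn := P.n_pos
  have hr : ∀ p : P.Grid, P.family.r (.inl p) ^ (1 + e) = (P.n : ℝ)⁻¹ * (P.n : ℝ) ^ (-e) := by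
    intro p
    have : P.family.r (.inl p) = (P.n : ℝ)⁻¹ := by simp [family, scale]
    rw [this, Real.rpow_add (by positivity), Real.rpow_one, Real.inv_rpow hn.le,
      Real.rpow_neg hn.le]
  simp only [hr]
  rw [tsum_fintype, Finset.sum_const, Finset.card_univ, nsmul_eq_mul,
    ← ENNReal.ofReal_natCast, ← ENNReal.ofReal_mul (by positivity)]
  apply ENNReal.ofReal_le_ofReal
  have hc : (Fintype.card P.Grid : ℝ) ≤ 3 * P.n := by exact_mod_cast P.card_grid_le
  calc _ ≤ (3 * P.n : ℝ) * ((P.n : ℝ)⁻¹ * (P.n : ℝ) ^ (-e)) := by gcongr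
    _ = _ := by field_simp

/-- At each level the number of squares times their ratio is at most 1, so only the power `e` of the
ratio remains, and that decays geometrically in the level. -/
lemma tsum_small_le {e : ℝ} (he : 0 < e) :
    ∑' w : P.Small, ENNReal.ofReal (P.family.r (.inr w) ^ (1 + e)) ≤
    ENNReal.ofReal ((P.n : ℝ) ^ (-e) * (1 - (1 / 2) ^ e)⁻¹) := by
  have hn := P.n_pos
  have hq1 : ((1 : ℝ) / 2) ^ e < 1 := Real.rpow_lt_one (by norm_num) (by norm_num) he
  have hq0 : (0 : ℝ) ≤ (1 / 2) ^ e := by positivity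
  have hlevel : ∀ k, ∑' o : Option (Fin (P.N k)),
      ENNReal.ofReal (P.family.r (.inr ⟨k, o⟩) ^ (1 + e)) ≤
      ENNReal.ofReal ((P.n : ℝ) ^ (-e) * ((1 / 2) ^ e) ^ k) := by
    intro k
    have hs := size_pos k
    change ∑' o : Option (Fin (P.N k)), ENNReal.ofReal ((size k / P.n) ^ (1 + e)) ≤ _
    rw [tsum_fintype, Finset.sum_const, Finset.card_univ, nsmul_eq_mul,
      ← ENNReal.ofReal_natCast, ← ENNReal.ofReal_mul (by positivity)]
    apply ENNReal.ofReal_le_ofReal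
    have h1 : (Fintype.card (Option (Fin (P.N k))) : ℝ) ≤ 4 * 2 ^ k := by
      have h2 := P.N_le k
      have h3 : 1 ≤ 2 ^ k := Nat.one_le_two_pow
      rw [Fintype.card_option, Fintype.card_fin]
      exact_mod_cast (by omega : P.N k + 1 ≤ 4 * 2 ^ k)
    have h2 : size k ^ e ≤ ((1 / 2) ^ e) ^ k := by
      rw [← Real.rpow_natCast, ← Real.rpow_mul (by norm_num), mul_comm e,
        Real.rpow_mul (by norm_num), Real.rpow_natCast]
      refine Real.rpow_le_rpow hs.le ?_ he.le
      have : (0 : ℝ) < (1 / 2) ^ k := by positivity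
      unfold size
      linarith
    have h3 : 4 * 2 ^ k * (size k / P.n) ≤ 1 := by
      have := two_pow_mul_size k
      have h5 := P.five_le'
      rw [show 4 * 2 ^ k * (size k / P.n) = 4 * (2 ^ k * size k) / P.n by ring, this,
        div_le_one hn]
      linarith
    rw [Real.rpow_add (by positivity), Real.rpow_one, Real.div_rpow hs.le hn.le]
    calc _ ≤ 4 * 2 ^ k * (size k / P.n * (size k ^ e / (P.n : ℝ) ^ e)) := by gcongr
      _ = (4 * 2 ^ k * (size k / P.n)) * (size k ^ e * (P.n : ℝ) ^ (-e)) := by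
        rw [Real.rpow_neg hn.le]; ring
      _ ≤ 1 * (((1 / 2) ^ e) ^ k * (P.n : ℝ) ^ (-e)) := by gcongr
      _ = _ := by ring
  rw [ENNReal.tsum_sigma' (fun w : P.Small => ENNReal.ofReal (P.family.r (.inr w) ^ (1 + e)))]
  refine (ENNReal.tsum_le_tsum hlevel).trans (le_of_eq ?_)
  rw [← ENNReal.ofReal_tsum_of_nonneg (fun k => by positivity)
    ((summable_geometric_of_lt_one hq0 hq1).mul_left _), tsum_mul_left,
    tsum_geometric_of_lt_one hq0 hq1]

lemma exists_tsum_le_one {e : ℝ} (he : 0 < e) : ∃ n : ℕ, 5 ≤ n ∧ ∀ P : Comb, P.n = n →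
    ∑' i, ENNReal.ofReal (P.family.r i ^ (1 + e)) ≤ 1 := by
  have hlim : Tendsto (fun n : ℕ => (n : ℝ) ^ (-e) * (3 + (1 - (1 / 2) ^ e)⁻¹)) atTop (𝓝 0) := by
    simpa using ((tendsto_rpow_neg_atTop he).comp tendsto_natCast_atTop_atTop).mul_const
      (3 + (1 - (1 / 2 : ℝ) ^ e)⁻¹)
  obtain ⟨n, hn, hn5⟩ := ((hlim.eventually (ge_mem_nhds one_pos)).and
    (eventually_ge_atTop 5)).exists
  refine ⟨n, hn5, ?_⟩
  rintro P rfl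
  have hq1 : ((1 : ℝ) / 2) ^ e < 1 := Real.rpow_lt_one (by norm_num) (by norm_num) he
  have hpos : 0 ≤ (1 - ((1 : ℝ) / 2) ^ e)⁻¹ := inv_nonneg.2 (by linarith)
  rw [Summable.tsum_sum ENNReal.summable ENNReal.summable]
  calc _ ≤ _ := add_le_add (P.tsum_grid_le e) (P.tsum_small_le he)
    _ = ENNReal.ofReal ((P.n : ℝ) ^ (-e) * (3 + (1 - (1 / 2) ^ e)⁻¹)) := by
      rw [← ENNReal.ofReal_add (by positivity) (by positivity)]
      congr 1
      ring
    _ ≤ 1 := ENNReal.ofReal_le_one.2 hn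

instance : Infinite P.Idx := by
  have : Function.Injective fun k : ℕ => (Sum.inr ⟨k, none⟩ : P.Idx) := by
    intro j k h
    exact congrArg Sigma.fst (Sum.inr_injective h)
  exact Infinite.of_injective _ this

lemma nonempty_enumeration : Nonempty (ℕ ≃ P.Idx) := by
  obtain ⟨d⟩ := nonempty_denumerable P.Idx
  exact ⟨(Denumerable.eqv P.Idx).symm⟩

/-- For suitable `n`, all the families have similarity dimension less than `1 + ε`. -/
lemma exists_sdim_lt {ε : ℝ} (hε : 0 < ε) : ∃ n : ℕ, 5 ≤ n ∧ ∀ P : Comb, P.n = n →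
    ∀ e : ℕ ≃ P.Idx, (P.family.system e).sdim < 1 + ENNReal.ofReal ε := by
  obtain ⟨n, hn5, hn⟩ := exists_tsum_le_one (half_pos hε)
  refine ⟨n, hn5, fun P hP e => ?_⟩
  have h := P.family.sdim_system_le e (1 + (ε / 2).toNNReal) (by
    simpa [Real.coe_toNNReal _ (half_pos hε).le] using hn P hP)
  refine h.trans_lt ?_
  push_cast
  refine ENNReal.add_lt_add_left ENNReal.one_ne_top ?_
  exact (ENNReal.ofReal_lt_ofReal_iff hε).2 (half_lt_self hε)

end Comb

/-! ### A connected attractor that is not path connected -/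

namespace Comb

open IIFS

section Connected

variable (P : Comb)

lemma origin_mem : (0 : Plane) ∈ P.attractor :=
  (P.joinedIn_origin_three ⟨le_rfl, P.n_pos.le⟩).source_mem

lemma isClosed_component (x : Plane) : IsClosed (connectedComponentIn P.attractor x) := by
  by_cases hx : x ∈ P.attractor
  · refine isClosed_of_closure_subset ?_
    exact isPreconnected_connectedComponentIn.closure.subset_connectedComponentIn
      (subset_closure (mem_connectedComponentIn hx))
      (closure_minimal (connectedComponentIn_subset _ _) P.isClosed_attractor)
  · simp [connectedComponentIn_eq_empty hx]

lemma mem_component_of_joinedIn {x y : Plane} (h : JoinedIn P.attractor x y) :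
    y ∈ connectedComponentIn P.attractor x := by
  refine (isPreconnected_range h.somePath.continuous).subset_connectedComponentIn ⟨0, by simp⟩
    (range_subset_iff.2 h.somePath_mem) ⟨1, by simp⟩

/-- The link ends on the line of column k + 1, at height 2 `c k` in units of `size (k + 1)`. The
hypothesis says that this column is tall enough to be met there and descended. -/
lemma joinedIn_foot_succ (h : ∀ k, 2 * P.c k ≤ P.N (k + 1)) (k : ℕ) :
    JoinedIn P.attractor (P.pt (3 - 4 * size k) 2) (P.pt (3 - 4 * size (k + 1)) 2) := by
  have hs := size_pos k
  have h1 := (P.joinedIn_foot_row k (x := 2 * size k) ⟨by linarith, le_rfl⟩).mono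
    inter_subset_left
  have hc : (2 * P.c k : ℝ) ≤ P.N (k + 1) := by exact_mod_cast h k
  have h2 := (P.joinedIn_foot (k + 1) (y := size k * P.c k)
    ⟨by positivity, by rw [size_succ]; nlinarith⟩).mono inter_subset_left
  rw [show 3 - 4 * size (k + 1) = 3 - 4 * size k + 2 * size k by rw [size_succ]; ring] at h2 ⊢
  exact h1.trans h2.symm

lemma foot_mem (k : ℕ) : P.pt (3 - 4 * size k) 2 ∈ P.attractor :=
  (P.joinedIn_foot k ⟨le_rfl, mul_nonneg (by positivity) (size_pos k).le⟩).source_mem.1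

lemma joinedIn_foot_zero (h : ∀ k, 2 * P.c k ≤ P.N (k + 1)) (k : ℕ) :
    JoinedIn P.attractor (P.pt (3 - 4 * size 0) 2) (P.pt (3 - 4 * size k) 2) := by
  induction k with
  | zero => exact JoinedIn.refl (P.foot_mem 0)
  | succ k ih => exact ih.trans (P.joinedIn_foot_succ h k)

lemma tendsto_foot : Tendsto (fun k => P.pt (3 - 4 * size k) 2) atTop (𝓝 (P.pt 3 2)) := by
  have h1 : Tendsto (fun k => 3 - 4 * size k) atTop (𝓝 3) := by
    simpa using (tendsto_size.const_mul 4).const_sub 3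
  have h2 : Continuous fun x : ℝ => P.pt x 2 := by
    unfold pt
    refine (PiLp.continuous_toLp 2 _).comp (continuous_pi fun m => ?_)
    fin_cases m
    · exact continuous_id.div_const _
    · exact continuous_const
  exact (h2.tendsto 3).comp h1

lemma isConnected_attractor (h : ∀ k, 2 * P.c k ≤ P.N (k + 1)) : IsConnected P.attractor := by
  have hn := P.five_le'
  refine P.family.isConnected_limitSet P.isClosed_attractor P.origin_mem fun i => ?_
  change _ ∈ connectedComponentIn P.attractor 0
  rcases i with p | w
  · exact P.mem_component_of_joinedIn (P.joinedIn_origin_grid p)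
  · have h1 : P.pt 3 2 ∈ connectedComponentIn P.attractor 0 :=
      P.mem_component_of_joinedIn (P.joinedIn_origin_three ⟨by norm_num, by linarith⟩)
    -- The columns attach to the rest only in the limit: components are closed, and the feet
    -- converge to this point.
    have h2 : P.pt 3 2 ∈ connectedComponentIn P.attractor (P.pt (3 - 4 * size 0) 2) :=
      (P.isClosed_component _).mem_of_tendsto P.tendsto_foot
        (Eventually.of_forall fun k => P.mem_component_of_joinedIn (P.joinedIn_foot_zero h k))
    rw [connectedComponentIn_eq h1, ← connectedComponentIn_eq h2]
    exact P.mem_component_of_joinedIn ((P.joinedIn_foot_zero h w.1).trans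
      ((P.joinedIn_foot_small w).mono inter_subset_left))

end Connected

/-- The comb whose columns all have the same height and are linked alternately at the bottom and
at the top. -/
def zigzag (n : ℕ) (hn : 5 ≤ n) : Comb where
  n := n
  five_le := hn
  N k := 2 ^ k
  N_le k := by omega
  c k := if Even k then 0 else 2 ^ k - 1
  c_lt k := by
    have : 0 < 2 ^ k := by positivity
    split_ifs <;> omega

variable (n : ℕ) (hn : 5 ≤ n)

lemma isConnected_zigzag : IsConnected (zigzag n hn).attractor := by
  refine isConnected_attractor _ fun k => ?_
  simp only [zigzag, pow_succ]
  split_ifs <;> omega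

lemma not_joinedIn_zigzag :
    ¬ JoinedIn (zigzag n hn).attractor ((zigzag n hn).pt (3 - 4 * size 0) 2) 0 := by
  intro h
  set P := zigzag n hn
  have hnpos := P.n_pos
  let γ := h.somePath
  have hγK : ∀ t, γ t ∈ P.attractor := h.somePath_mem
  let X : I → ℝ := fun t => P.n * γ t 0
  let Y : I → ℝ := fun t => P.n * γ t 1
  have hγc : Continuous γ := γ.continuous
  have hX : Continuous X := by fun_prop
  have hY : Continuous Y := by fun_prop
  have hX0 : X 0 = 2 := by
    simp only [X, γ.source, pt_zero, size_zero]
    field_simp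
    norm_num
  have hY0 : Y 0 = 2 := by
    simp only [Y, γ.source, pt_one]
    field_simp
  have hX1 : X 1 = 0 := by simp [X]
  have hopen : IsOpen {t | 1 < X t ∧ X t < 3 ∧ 1 < Y t} :=
    (isOpen_lt continuous_const hX).inter
      ((isOpen_lt hX continuous_const).inter (isOpen_lt continuous_const hY))
  obtain ⟨t₀, ht₀, hmin⟩ := hopen.isClosed_compl.isCompact.exists_isLeast
    ⟨1, fun h => by have := h.1; rw [hX1] at this; norm_num at this⟩
  have hlt : ∀ t < t₀, 1 < X t ∧ X t < 3 ∧ 1 < Y t := fun t ht => by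
    by_contra hcon
    exact absurd (hmin hcon) (not_le.2 ht)
  have h0t : 0 < t₀ := by
    refine lt_of_le_of_ne t₀.2.1 fun h => ht₀ ?_
    rw [← h, mem_ofPred_eq, hX0, hY0]
    norm_num
  -- Until the first exit time the path stays in small squares, where X ≥ 2 and Y ≥ 2. These bounds
  -- survive in the limit, so the region can only be left through X = 3.
  have hXt : X t₀ = 3 := by
    have hcl : IsClosed {t | 2 ≤ X t ∧ X t ≤ 3 ∧ 2 ≤ Y t} :=
      (isClosed_le continuous_const hX).inter
        ((isClosed_le hX continuous_const).inter (isClosed_le continuous_const hY))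
    have hsub : Iio t₀ ⊆ {t | 2 ≤ X t ∧ X t ≤ 3 ∧ 2 ≤ Y t} := by
      intro t ht
      obtain ⟨h1, h2, h3⟩ := hlt t ht
      obtain ⟨w, hw, hw'⟩ := P.exists_small_square (hγK t) h1 h2 h3
      obtain ⟨b1, b2, b3, b4⟩ := P.small_bounds w
      have := size_le w.1
      exact ⟨by linarith [hw.1], h2.le, b3.trans hw'.1⟩
    have hmem : t₀ ∈ closure (Iio t₀) := by
      rw [closure_Iio' (a := t₀) ⟨0, h0t⟩]
      exact mem_Iic.2 le_rfl
    obtain ⟨h1, h2, h3⟩ := closure_minimal hsub hcl hmem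
    by_contra hne
    exact ht₀ ⟨by linarith, lt_of_le_of_ne h2 hne, by linarith⟩
  -- Near `t₀` two heights differ by less than 1/8, while low and high links of size below 1/32 are
  -- more than 3/16 apart.
  obtain ⟨η, hη, hclose⟩ := Metric.continuous_iff.1 hY t₀ (1 / 16) (by norm_num)
  obtain ⟨t₁, ht₁, hball⟩ : ∃ t₁ < t₀, Icc t₁ t₀ ⊆ ball t₀ η := by
    obtain ⟨t₁, ht₁, hsub⟩ := exists_Ioc_subset_of_mem_nhds (ball_mem_nhds t₀ hη) ⟨0, h0t⟩
    obtain ⟨t₂, h2, h2'⟩ := exists_between ht₁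
    exact ⟨t₂, h2', fun s hs => hsub ⟨h2.trans_le hs.1, hs.2⟩⟩
  have hX₁ : X t₁ < 3 := (hlt t₁ ht₁).2.1
  have hsize : ∀ᶠ k in atTop, size k < min ((3 - X t₁) / 3) (1 / 32) :=
    tendsto_size.eventually (gt_mem_nhds (lt_min (by linarith) (by norm_num)))
  obtain ⟨k₀, hk₀⟩ := eventually_atTop.1 hsize
  have visit : ∀ k ≥ k₀, ∃ y, |y - Y t₀| < 1 / 16 ∧
      y ∈ Icc (2 + size k * P.c k) (2 + size k * P.c k + size k) := by
    intro k hk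
    have hs := size_pos k
    have hs' := (hk₀ k hk).trans_le (min_le_left _ _)
    obtain ⟨t, ht, hXk⟩ := intermediate_value_Icc ht₁.le hX.continuousOn
      (show 3 - 5 / 2 * size k ∈ Icc (X t₁) (X t₀) from ⟨by linarith, by linarith⟩)
    have htlt : t < t₀ := lt_of_le_of_ne ht.2 fun h => by
      rw [h, hXt] at hXk
      linarith
    refine ⟨Y t, hclose t (hball ht), (P.mem_of_gap (hγK t) hXk).resolve_left ?_⟩
    exact not_le.2 (hlt t htlt).2.2
  have hsk : ∀ k ≥ k₀, size k < 1 / 32 := fun k hk => (hk₀ k hk).trans_le (min_le_right _ _)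
  -- An even level has its link at the bottom, the next, odd one at the top.
  obtain ⟨y, hy, hy'⟩ := visit (2 * k₀) (by omega)
  obtain ⟨y', hyy, hyy'⟩ := visit (2 * k₀ + 1) (by omega)
  have e1 : P.c (2 * k₀) = 0 := by simp [P, zigzag]
  have e2 : (P.c (2 * k₀ + 1) : ℝ) = 2 ^ (2 * k₀ + 1) - 1 := by
    simp [P, zigzag]
  rw [e1] at hy'
  rw [e2] at hyy'
  have e3 := two_pow_mul_size (2 * k₀ + 1)
  have s1 := hsk (2 * k₀) (by omega)
  have s2 := hsk (2 * k₀ + 1) (by omega)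
  rw [abs_lt] at hy hyy
  have := hy'.2
  have := hyy'.1
  push_cast at *
  nlinarith

lemma not_isPathConnected_zigzag : ¬ IsPathConnected (zigzag n hn).attractor := fun h =>
  not_joinedIn_zigzag n hn (h.joinedIn _ (foot_mem _ 0) _ (origin_mem _))

lemma exists_continuum_not_isPathConnected {ε : ℝ} (hε : 0 < ε) :
    ∃ F : System unitSquare, (∀ i, IsSimilarity (F.map i)) ∧ F.OpenSetCondition ∧
      F.sdim < 1 + ENNReal.ofReal ε ∧ IsContinuum F.attractor ∧
      ¬ IsPathConnected F.attractor := by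
  obtain ⟨n, hn, hdim⟩ := exists_sdim_lt hε
  obtain ⟨e⟩ := (zigzag n hn).nonempty_enumeration
  refine ⟨(zigzag n hn).family.system e, SquareFamily.isSimilarity_system _ e,
    SquareFamily.openSetCondition_system _ e, hdim _ rfl e,
    SquareFamily.isContinuum_attractor _ e (isClosed_attractor _) (isConnected_zigzag n hn),
    fun h => not_isPathConnected_zigzag n hn (SquareFamily.isPathConnected_limitSet _ e h)⟩

end Comb

/-! ### A curve that is not a Hölder curve -/

namespace Comb

open IIFS

section Curve

variable (P : Comb)

lemma dist_le_add (p q : Plane) : dist p q ≤ |p 0 - q 0| + |p 1 - q 1| := by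
  rw [EuclideanSpace.dist_eq, Fin.sum_univ_two, Real.dist_eq, Real.dist_eq]
  refine Real.sqrt_le_iff.2 ⟨by positivity, ?_⟩
  nlinarith [mul_nonneg (abs_nonneg (p 0 - q 0)) (abs_nonneg (p 1 - q 1))]

lemma abs_sub_le_dist (p q : Plane) (m : Fin 2) : |p m - q m| ≤ dist p q := by
  rw [dist_eq_norm]
  simpa using PiLp.norm_apply_le (p - q) m

lemma box_subset_closedBall (k : ℕ) :
    P.box k ⊆ closedBall (P.pt 3 2) ((4 + P.N k) * size k) := by
  rintro p ⟨h0, h1⟩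
  have hn := P.n_pos
  have hn1 : 1 ≤ (P.n : ℝ) := by linarith [P.five_le']
  rw [mem_closedBall]
  refine (dist_le_add _ _).trans ?_
  rw [pt_zero, pt_one]
  have key : ∀ {a b s : ℝ}, |P.n * a - b| ≤ s → |a - b / P.n| ≤ s := by
    intro a b s h
    rw [show P.n * a - b = P.n * (a - b / P.n) by field_simp, abs_mul, abs_of_pos hn] at h
    exact (le_mul_of_one_le_left (abs_nonneg _) hn1).trans h
  have h2 : |p 0 - 3 / P.n| ≤ 4 * size k := key (abs_le.2 ⟨by linarith [h0.1],
    by linarith [h0.2, size_pos k]⟩)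
  have h3 : |p 1 - 2 / P.n| ≤ P.N k * size k := key (abs_le.2 ⟨by linarith [h1.1, h1.2],
    by linarith [h1.2]⟩)
  linarith

lemma map_mem_box (w : P.Small) {q : Plane} (hq : q ∈ unitSquare) :
    P.family.map (.inr w) q ∈ P.box w.1 := by
  obtain ⟨b1, b2, b3, b4⟩ := P.small_bounds w
  have hs := size_pos w.1
  have e : ∀ m, size w.1 * q m ∈ Icc 0 (size w.1) := fun m =>
    ⟨mul_nonneg hs.le (hq m).1, mul_le_of_le_one_right hs.le (hq m).2⟩
  rw [family_map, pt_mem_box]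
  simp only [scale, Sum.elim_inr]
  refine ⟨⟨?_, ?_⟩, ?_, ?_⟩ <;> linarith [(e 0).1, (e 0).2, (e 1).1, (e 1).2]

lemma exists_level {u : ℝ} (h : 2 ≤ u) (h' : u < 3) :
    ∃ k, u ∈ Icc (3 - 4 * size k) (3 - 2 * size k) := by
  have hex : ∃ k, u < 3 - 4 * size k := by
    have : Tendsto (fun k => 3 - 4 * size k) atTop (𝓝 3) := by
      simpa using (tendsto_size.const_mul 4).const_sub 3
    exact (this.eventually (lt_mem_nhds h')).exists
  classical
  have hspec := Nat.find_spec hex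
  cases hk : Nat.find hex with
  | zero =>
    rw [hk, size_zero] at hspec
    linarith
  | succ k =>
    have hmin := Nat.find_min hex (m := k) (by omega)
    rw [hk, size_succ] at hspec
    exact ⟨k, not_lt.1 hmin, by linarith⟩

/-- With all links at the bottom, the bottom rows of the levels fit together into one segment ending
at the hub. -/
lemma base_mem (h : ∀ k, P.c k = 0) {u : ℝ} (hu : u ∈ Icc (2 : ℝ) 3) :
    P.pt u 2 ∈ P.attractor := by
  have hn := P.five_le'
  rcases hu.2.lt_or_eq with hlt | rfl
  · obtain ⟨k, hk⟩ := exists_level hu.1 hlt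
    have := P.row_mem k (x := u - (3 - 4 * size k)) ⟨by linarith [hk.1], by linarith [hk.2]⟩
    simpa [h k] using this
  · exact P.pt_three_mem ⟨by norm_num, by linarith⟩

lemma joinedIn_hub_foot (h : ∀ k, P.c k = 0) (k : ℕ) :
    JoinedIn (P.attractor ∩ P.box k) (P.pt 3 2) (P.pt (3 - 4 * size k) 2) := by
  have hs := size_pos k
  have hs' := size_le k
  refine P.joinedIn_horizontal fun u hu => ?_
  rw [uIcc_of_ge (by linarith)] at hu
  refine ⟨P.base_mem h ⟨by linarith [hu.1], hu.2⟩, P.pt_mem_box.2 ⟨hu, le_rfl, ?_⟩⟩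
  have : 0 ≤ P.N k * size k := by positivity
  linarith

/-- If the columns are linked at the bottom and their heights tend to zero, then the attractor is a
curve. -/
lemma exists_curve (h : ∀ k, P.c k = 0) (hN : Tendsto (fun k => P.N k * size k) atTop (𝓝 0))
    (e : ℕ ≃ P.Idx) : ∃ f : I → Plane, Continuous f ∧ range f = P.attractor := by
  have hn := P.five_le'
  have hhub : JoinedIn P.attractor 0 (P.pt 3 2) :=
    P.joinedIn_origin_three ⟨by norm_num, by linarith⟩
  -- The last leg of the path from the hub to its image is the image of the path from the origin to
  -- the hub, so it stays in square `i`.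
  have hstep : ∀ i, JoinedIn (P.family.map i '' P.attractor) (P.family.b i)
      (P.family.map i (P.pt 3 2)) := fun i => by
    have := hhub.map (P.family.continuous_map i)
    rwa [SquareFamily.map_zero] at this
  have hinv : ∀ i, P.family.map i '' P.attractor ⊆ P.attractor := fun i =>
    image_subset_iff.2 fun x hx => P.family.map_mem_limitSet i hx
  let d : P.Idx → ℝ := Sum.elim (fun _ => 2) fun w => (4 + P.N w.1) * size w.1
  refine P.family.exists_curve e P.isClosed_attractor (z := P.pt 3 2) (d := d) ?_ ?_ ?_
  · have hlevel : Tendsto (fun k => (4 + P.N k) * size k) atTop (𝓝 0) := by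
      simpa [add_mul] using (tendsto_size.const_mul 4).add hN
    intro U hU
    obtain ⟨k₀, hk₀⟩ := eventually_atTop.1 (hlevel hU)
    rw [mem_map]
    filter_upwards [P.eventually_small k₀] with i ⟨w, hi, hw⟩
    rw [hi]
    exact hk₀ w.1 hw
  · intro i
    have hr : P.family.r i ≤ P.scale i := div_le_self (P.scale_pos i).le (by linarith)
    refine hr.trans ?_
    rcases i with p | w
    · simp [scale, d]
    · have hs := size_pos w.1
      have : 0 ≤ P.N w.1 * size w.1 := by positivity
      simp only [scale, d, Sum.elim_inr]
      linarith
  · rintro (p | w)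
    · have hsub : P.attractor ⊆ P.family.limitSet ∩ closedBall (P.pt 3 2) 2 := by
        intro q hq
        refine ⟨hq, (dist_le_add _ _).trans ?_⟩
        have h1 := P.family.limitSet_subset_unitSquare hq
        have h2 := P.family.limitSet_subset_unitSquare hhub.target_mem
        have h3 : ∀ m, |q m - P.pt 3 2 m| ≤ 1 := fun m =>
          abs_le.2 ⟨by linarith [(h1 m).1, (h2 m).2], by linarith [(h1 m).2, (h2 m).1]⟩
        linarith [h3 0, h3 1]
      exact ((hhub.symm.trans (P.joinedIn_origin_grid p)).trans
        ((hstep _).mono (hinv _))).mono hsub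
    · have hsub : P.attractor ∩ P.box w.1 ⊆
          P.family.limitSet ∩ closedBall (P.pt 3 2) (d (.inr w)) :=
        inter_subset_inter_right _ (P.box_subset_closedBall w.1)
      refine (((P.joinedIn_hub_foot h w.1).trans (P.joinedIn_foot_small w)).trans
        ((hstep _).mono (subset_inter (hinv _) ?_))).mono hsub
      rintro _ ⟨q, hq, rfl⟩
      exact P.map_mem_box w (P.family.limitSet_subset_unitSquare hq)

/-- The top of the `k`-th column. -/
def tip (k : ℕ) : Plane := P.pt (3 - 4 * size k) (2 + P.N k * size k)

lemma tip_mem (k : ℕ) : P.tip k ∈ P.attractor :=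
  P.column_mem k ⟨mul_nonneg (by positivity) (size_pos k).le, le_rfl⟩

/-- A curve that travels from one tip to the tip of a later column must go far down on the way. -/
lemma exists_descent (h : ∀ k, P.c k = 0) {f : I → Plane} (hf : Continuous f)
    (hfK : ∀ t, f t ∈ P.attractor) {j k : ℕ} (hjk : j < k) {s t : I} (hs : f s = P.tip j)
    (ht : f t = P.tip k) :
    ∃ u ∈ uIcc s t, (P.N j * size j - size j) / P.n ≤ dist (f u) (f s) := by
  have hn := P.n_pos
  have hX : Continuous fun u => P.n * f u 0 := by fun_prop
  have e1 : P.n * f s 0 = 3 - 4 * size j := by rw [hs, tip, pt_zero, mul_div_cancel₀ _ hn.ne']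
  have e2 : P.n * f t 0 = 3 - 4 * size k := by rw [ht, tip, pt_zero, mul_div_cancel₀ _ hn.ne']
  have hsj := size_pos j
  have hh := size_le_half hjk
  -- The curve crosses the middle of the gap to the right of column `j`, where the attractor reaches
  -- no higher than the link at the bottom.
  obtain ⟨u, hu, hXu⟩ := intermediate_value_uIcc (a := s) (b := t) hX.continuousOn
    (show 3 - 5 / 2 * size j ∈ uIcc (P.n * f s 0) (P.n * f t 0) by
      rw [e1, e2, uIcc_of_le (by linarith)]
      constructor <;> linarith)
  refine ⟨u, hu, le_trans ?_ (abs_sub_le_dist (f u) (f s) 1)⟩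
  have hYu : P.n * f u 1 ≤ 2 + size j := by
    rcases P.mem_of_gap (hfK u) hXu with h1 | h1
    · linarith
    · simpa [h j] using h1.2
  have hYs : P.n * f s 1 = 2 + P.N j * size j := by
    rw [hs, tip, pt_one, mul_div_cancel₀ _ hn.ne']
  rw [div_le_iff₀ hn, abs_sub_comm]
  have := le_abs_self (f s 1 - f u 1)
  nlinarith

/-- Among `m + 2` times two are within `1 / m` of each other. -/
lemma exists_close {m : ℕ} (hm : 0 < m) (τ : ℕ → I) :
    ∃ j k, j < k ∧ k < m + 2 ∧ |(τ j : ℝ) - τ k| ≤ 1 / m := by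
  have hm' : (0 : ℝ) < m := by exact_mod_cast hm
  obtain ⟨j, hj, k, hk, hne, heq⟩ := Finset.exists_ne_map_eq_of_card_lt_of_maps_to
    (s := Finset.range (m + 2)) (t := Finset.range (m + 1)) (by simp)
    (f := fun j => ⌊(τ j : ℝ) * m⌋₊) (fun j _ => by
      simp only [Finset.coe_range, mem_Iio]
      have h : (τ j : ℝ) * m ≤ m := mul_le_of_le_one_left hm'.le (τ j).2.2
      have := Nat.floor_le_floor h
      simp only [Nat.floor_natCast] at this
      omega)
  simp only [Finset.mem_range] at hj hk
  have hclose : |(τ j : ℝ) - τ k| ≤ 1 / m := by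
    have h1 := Nat.floor_le (mul_nonneg (τ j).2.1 hm'.le)
    have h2 := Nat.floor_le (mul_nonneg (τ k).2.1 hm'.le)
    have h3 := Nat.lt_floor_add_one ((τ j : ℝ) * m)
    have h4 := Nat.lt_floor_add_one ((τ k : ℝ) * m)
    rw [heq] at h1 h3
    have h5 : |(τ j : ℝ) - τ k| * m = |(τ j : ℝ) * m - τ k * m| := by
      rw [← sub_mul, abs_mul, abs_of_pos hm']
    rw [le_div_iff₀ hm', h5, abs_le]
    constructor <;> linarith
  rcases hne.lt_or_gt with h | h
  · exact ⟨j, k, h, hk, hclose⟩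
  · exact ⟨k, j, h, hj, by rwa [abs_sub_comm]⟩

end Curve

/-- The comb whose columns are linked at the bottom and have logarithmically decaying heights. -/
def hairbrush (n : ℕ) (hn : 5 ≤ n) : Comb where
  n := n
  five_le := hn
  N k := 2 + 2 ^ k / (Nat.log 2 (k + 1) + 1)
  N_le k := by
    have h1 : 2 ^ k / (Nat.log 2 (k + 1) + 1) ≤ 2 ^ k := Nat.div_le_self _ _
    have h2 : 1 ≤ 2 ^ k := Nat.one_le_two_pow
    omega
  c _ := 0
  c_lt k := by positivity

variable (n : ℕ) (hn : 5 ≤ n)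

lemma tendsto_height_hairbrush :
    Tendsto (fun k => (hairbrush n hn).N k * size k) atTop (𝓝 0) := by
  have hlog : Tendsto (fun k => Nat.log 2 (k + 1)) atTop atTop := by
    refine tendsto_atTop.2 fun m => ?_
    filter_upwards [eventually_ge_atTop (2 ^ m)] with k hk
    exact Nat.le_log_of_pow_le one_lt_two (by omega)
  have hlim : Tendsto (fun k => 2 * size k + 1 / 4 * (1 / ((Nat.log 2 (k + 1) : ℕ) + 1 : ℝ))) atTop
      (𝓝 0) := by
    simpa using (tendsto_size.const_mul 2).add
      ((tendsto_one_div_add_atTop_nhds_zero_nat.comp hlog).const_mul (1 / 4 : ℝ))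
  refine squeeze_zero (fun k => mul_nonneg (by positivity) (size_pos k).le) (fun k => ?_) hlim
  have hs := size_pos k
  have h1 : ((2 ^ k / (Nat.log 2 (k + 1) + 1) : ℕ) : ℝ) ≤ 2 ^ k / ((Nat.log 2 (k + 1) : ℕ) + 1) := by
    refine Nat.cast_div_le.trans (le_of_eq ?_)
    push_cast
    rfl
  have h2 := two_pow_mul_size k
  simp only [hairbrush, Nat.cast_add, Nat.cast_ofNat]
  calc _ ≤ (2 + 2 ^ k / ((Nat.log 2 (k + 1) : ℕ) + 1 : ℝ)) * size k := by gcongr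
    _ = 2 * size k + (2 ^ k * size k) * (1 / ((Nat.log 2 (k + 1) : ℕ) + 1 : ℝ)) := by ring
    _ = _ := by rw [h2]

/-- Of the summand 2 in `N`, one unit makes up for the rounding in the division and the other for
the subtracted `size j`. -/
lemma height_hairbrush_ge {j m : ℕ} (hj : j + 1 < 2 ^ (m + 2)) :
    1 / 4 / ((m : ℝ) + 2) ≤ (hairbrush n hn).N j * size j - size j := by
  have hs := size_pos j
  have hL : Nat.log 2 (j + 1) + 1 ≤ m + 2 := Nat.log_lt_of_lt_pow (by omega) hj
  have h1 : 2 ^ j < (2 ^ j / (Nat.log 2 (j + 1) + 1) + 1) * (m + 2) :=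
    (Nat.lt_mul_of_div_lt (Nat.lt_succ_self _) (Nat.succ_pos _)).trans_le
      (Nat.mul_le_mul_left _ hL)
  have h2 : (2 : ℝ) ^ j ≤ ((2 ^ j / (Nat.log 2 (j + 1) + 1) : ℕ) + 1) * ((m : ℝ) + 2) := by
    exact_mod_cast h1.le
  have h3 := two_pow_mul_size j
  rw [div_le_iff₀ (by positivity), ← h3]
  simp only [hairbrush, Nat.cast_add, Nat.cast_ofNat]
  nlinarith

lemma not_holder_hairbrush {C r : ℝ≥0} {f : I → Plane} (hr : 0 < r) (hf : HolderWith C r f) :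
    range f ≠ (hairbrush n hn).attractor := by
  intro hrange
  set P := hairbrush n hn
  have hnpos := P.n_pos
  have hfK : ∀ t, f t ∈ P.attractor := fun t => hrange ▸ mem_range_self t
  have hτ : ∀ k, P.tip k ∈ range f := fun k => by rw [hrange]; exact P.tip_mem k
  choose τ hτ using hτ
  -- Two of the first 2^m + 2 tips are visited within time 2^(-m). The descent between them, at
  -- least 1/(4n(m + 2)), is at most C · 2^(-rm), which fails for large `m`.
  have key : ∀ m : ℕ, 1 ≤ 4 * P.n * C * (((m : ℝ) + 2) * (((1 / 2 : ℝ) ^ (r : ℝ)) ^ m)) := by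
    intro m
    obtain ⟨j, k, hjk, hk, hclose⟩ := exists_close (Nat.two_pow_pos m) τ
    obtain ⟨u, hu, hdist⟩ :=
      P.exists_descent (fun _ => rfl) (hf.continuous hr) hfK hjk (hτ j) (hτ k)
    have hj : j + 1 < 2 ^ (m + 2) := by
      have : 1 ≤ 2 ^ m := Nat.one_le_two_pow
      rw [pow_add]
      omega
    have h1 : dist u (τ j) ≤ (1 / 2) ^ m := by
      have h2 : |(u : ℝ) - τ j| ≤ |(τ k : ℝ) - τ j| := by
        have hu' : (u : ℝ) ∈ uIcc (τ j : ℝ) (τ k) := by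
          rcases le_total (τ j) (τ k) with h | h
          · rw [uIcc_of_le h] at hu
            rw [uIcc_of_le (by exact_mod_cast h)]
            exact ⟨hu.1, hu.2⟩
          · rw [uIcc_of_ge h] at hu
            rw [uIcc_of_ge (by exact_mod_cast h)]
            exact ⟨hu.1, hu.2⟩
        exact abs_sub_left_of_mem_uIcc hu'
      rw [Subtype.dist_eq, Real.dist_eq, one_div_pow]
      refine h2.trans ?_
      rw [abs_sub_comm]
      exact_mod_cast hclose
    have h2 : dist (f u) (f (τ j)) ≤ C * ((1 / 2 : ℝ) ^ (r : ℝ)) ^ m := by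
      refine (hf.dist_le u (τ j)).trans ?_
      gcongr
      refine (Real.rpow_le_rpow dist_nonneg h1 r.coe_nonneg).trans (le_of_eq ?_)
      rw [← Real.rpow_natCast, ← Real.rpow_natCast, ← Real.rpow_mul (by norm_num),
        ← Real.rpow_mul (by norm_num), mul_comm]
    have h3 := (div_le_div_of_nonneg_right (height_hairbrush_ge n hn hj) hnpos.le).trans
      (hdist.trans h2)
    rw [div_le_iff₀ hnpos, div_le_iff₀ (by positivity)] at h3
    linarith
  have hq1 : ((1 : ℝ) / 2) ^ (r : ℝ) < 1 :=
    Real.rpow_lt_one (by norm_num) (by norm_num) (by exact_mod_cast hr)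
  have hq0 : (0 : ℝ) ≤ (1 / 2) ^ (r : ℝ) := by positivity
  have hlim : Tendsto (fun m : ℕ => 4 * P.n * C * (((m : ℝ) + 2) * (((1 / 2 : ℝ) ^ (r : ℝ)) ^ m)))
      atTop (𝓝 0) := by
    have := ((tendsto_self_mul_const_pow_of_lt_one hq0 hq1).add
      ((tendsto_pow_atTop_nhds_zero_of_lt_one hq0 hq1).const_mul 2)).const_mul (4 * P.n * C : ℝ)
    simpa [add_mul] using this
  exact absurd (ge_of_tendsto' hlim key) (by norm_num)

lemma exists_curve_not_holder {ε : ℝ} (hε : 0 < ε) :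
    ∃ F : System unitSquare, (∀ i, IsSimilarity (F.map i)) ∧ F.OpenSetCondition ∧
      F.sdim < 1 + ENNReal.ofReal ε ∧ IsCurveImage F.attractor ∧
      ¬ IsHolderCurveImage F.attractor := by
  obtain ⟨n, hn, hdim⟩ := exists_sdim_lt hε
  obtain ⟨e⟩ := (hairbrush n hn).nonempty_enumeration
  obtain ⟨f, hf, hrange⟩ := (hairbrush n hn).exists_curve (fun _ => rfl)
    (tendsto_height_hairbrush n hn) e
  refine ⟨(hairbrush n hn).family.system e, SquareFamily.isSimilarity_system _ e,
    SquareFamily.openSetCondition_system _ e, hdim _ rfl e,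
    SquareFamily.isCurveImage_attractor _ e hf hrange, fun h => ?_⟩
  obtain ⟨C, r, g, hr, hg, hrange'⟩ := SquareFamily.exists_holder_of_isHolderCurveImage _ e h
  exact not_holder_hairbrush n hn hr hg hrange'

end Comb

end

theorem theorem1p1 :
    (∀ ε : ℝ, 0 < ε → ∃ F : IIFS.System IIFS.unitSquare,
      (∀ i, IIFS.IsSimilarity (F.map i)) ∧ F.OpenSetCondition ∧
      F.sdim < 1 + ENNReal.ofReal ε ∧
      IIFS.IsContinuum F.attractor ∧ ¬ IsPathConnected F.attractor) ∧
    (∀ ε : ℝ, 0 < ε → ∃ F : IIFS.System IIFS.unitSquare,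
      (∀ i, IIFS.IsSimilarity (F.map i)) ∧ F.OpenSetCondition ∧
      F.sdim < 1 + ENNReal.ofReal ε ∧
      IIFS.IsCurveImage F.attractor ∧ ¬ IIFS.IsHolderCurveImage F.attractor) :=
    ⟨fun _ hε => Comb.exists_continuum_not_isPathConnected hε,
      fun _ hε => Comb.exists_curve_not_holder hε⟩
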